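/- For an algebraically closed field $k$ of characteristic zero, let $\mathrm{C}(k)$ denote the following assertion. $\mathrm{C}(k)$: Let $X$ be a smooth, connected, $n$-dimensional projective variety over $k$, let $A\subset k$ be a subring that is finitely generated as a $\mathbf{Z}$-algebra, and let $X_A$ be a model of $X$ over $A$, that is, a flat scheme of finite type over $\operatorname{Spec} A$ together with an isomorphism $X\simeq X_A\times_{\operatorname{Spec} A}\operatorname{Spec} k$ over $k$. Then there is a dense set $S\subseteq \operatorname{Spec} A$ of closed points such that for every $s\in S$, the map $$F\colon H^n(X_s,\mathcal{O}_{X_s})\to H^n(X_s,\mathcal{O}_{X_s})$$ induced by the absolute Frobenius morphism of $X_s$ is bijective, where $X_s$ is the fiber of $X_A\to\operatorname{Spec} A$ over $s$, a scheme over the finite residue field $k(s)$. If $\mathrm{C}(\overline{\mathbf{Q}})$ holds, then $\mathrm{C}(k)$ holds for every algebraically closed field $k$ of characteristic zero. -/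

import Mathlib

open CategoryTheory CategoryTheory.Limits AlgebraicGeometry TopologicalSpace Opposite

universe u

noncomputable section

namespace FrobeniusReduction

/-! ### Projective morphisms -/

/-- Projective `N`-space over the integers, `Proj ℤ[x₀, …, x_N]` (with `ℤ` lifted to the ambient
universe). -/
def projectiveSpaceInt (N : ℕ) : Scheme.{u} :=
  letI := MvPolynomial.gradedAlgebra (σ := Fin (N + 1)) (R := ULift.{u} ℤ)
  Proj (MvPolynomial.homogeneousSubmodule (Fin (N + 1)) (ULift.{u} ℤ))

/-- Projective `N`-space over a scheme `S`, the product of `S` with projective `N`-space over the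
integers. -/
def projectiveSpace (N : ℕ) (S : Scheme.{u}) : Scheme.{u} :=
  pullback (terminal.from S) (terminal.from (projectiveSpaceInt.{u} N))

/-- The structure morphism of projective `N`-space over `S`. -/
def projectiveSpaceTo (N : ℕ) (S : Scheme.{u}) : projectiveSpace N S ⟶ S :=
  pullback.fst _ _

/-- A morphism `f : X ⟶ S` is projective if it factors as a closed immersion into some projective
space over `S` followed by the structure morphism. -/
def IsProjective {X S : Scheme.{u}} (f : X ⟶ S) : Prop :=
  ∃ (N : ℕ) (i : X ⟶ projectiveSpace N S), IsClosedImmersion i ∧ i ≫ projectiveSpaceTo N S = f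

/-! ### Cohomology of the structure sheaf and the action of Frobenius -/

/-- The structure sheaf of `X`, regarded as a sheaf of abelian groups. -/
def structureSheafAb (X : Scheme.{u}) :
    Sheaf (Opens.grothendieckTopology X) AddCommGrpCat.{u} :=
  (sheafCompose (Opens.grothendieckTopology X)
    (forget₂ CommRingCat.{u} RingCat.{u} ⋙ forget₂ RingCat.{u} AddCommGrpCat.{u})).obj X.sheaf

/-- The sheaf cohomology group `Hⁿ(X, 𝒪_X)`. -/
abbrev cohomology (X : Scheme.{u}) (n : ℕ) : Type u :=
  (structureSheafAb X).H n

/-- In a commutative ring in which the prime `p` vanishes, `x ↦ x ^ p` is additive.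
(The zero ring, which is the ring of sections over the empty set, is allowed.) -/
def powAddHom (R : Type u) [CommRing R] (p : ℕ) [hp : Fact p.Prime] (h : (p : R) = 0) :
    R →+ R where
  toFun x := x ^ p
  map_zero' := zero_pow hp.out.ne_zero
  map_add' x y := by
    obtain ⟨r, hr⟩ := exists_add_pow_prime_eq hp.out x y
    rw [hr, h]
    ring

/-- If `X` is a scheme over a ring of characteristic `p`, then `p` vanishes in every ring of
sections of the structure sheaf of `X`. -/
theorem natCast_sections_eq_zero {X : Scheme.{u}} {R : CommRingCat.{u}} (π : X ⟶ Spec R)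
    (p : ℕ) [CharP R p] (U : X.Opens) : (p : Γ(X, U)) = 0 := by
  let φ : R ⟶ Γ(X, U) :=
    (Scheme.ΓSpecIso R).inv ≫ π.appTop ≫ X.presheaf.map (homOfLE le_top).op
  have h : φ.hom (p : R) = (p : Γ(X, U)) := map_natCast φ.hom p
  rw [← h, CharP.cast_eq_zero R p, map_zero]

/-- The absolute Frobenius morphism of a scheme over a ring of characteristic `p` is the
identity on the underlying space; this is the corresponding morphism `𝒪_X ⟶ 𝒪_X` of sheaves of
abelian groups, `x ↦ x ^ p` on sections. -/
def frobeniusSheafHom {X : Scheme.{u}} {R : CommRingCat.{u}} (π : X ⟶ Spec R)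
    (p : ℕ) [Fact p.Prime] [CharP R p] : structureSheafAb X ⟶ structureSheafAb X where
  hom :=
    { app := fun U => AddCommGrpCat.ofHom
        (powAddHom (X.presheaf.obj U) p (natCast_sections_eq_zero π p U.unop))
      naturality := fun U V i => by
        refine ConcreteCategory.hom_ext _ _ fun (x : X.presheaf.obj U) => ?_
        exact (map_pow (X.presheaf.map i).hom x p).symm }

/-- The action of Frobenius on `Hⁿ(X, 𝒪_X)`. -/
def frobeniusCohomology {X : Scheme.{u}} {R : CommRingCat.{u}} (π : X ⟶ Spec R)
    (p : ℕ) [Fact p.Prime] [CharP R p] (n : ℕ) : cohomology X n →+ cohomology X n :=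
  Sheaf.H.map (frobeniusSheafHom π p) n

/-- For a morphism `f : Y ⟶ S` and a point `s` of `S`: the residue field `k(s)` has positive
characteristic and Frobenius acts bijectively on the `n`-th cohomology of the structure sheaf of
the fiber of `f` over `s`. -/
def FrobeniusBijectiveOnFiber {Y S : Scheme.{u}} (f : Y ⟶ S) (s : S) (n : ℕ) : Prop :=
  ∃ (p : ℕ) (_ : Fact p.Prime) (_ : CharP (S.residueField s) p),
    Function.Bijective (frobeniusCohomology (f.fiberToSpecResidueField s) p n)

/-! ### Models and the conjecture -/

/-- The morphism `Spec k ⟶ Spec A` induced by the inclusion of a subring `A` of `k`. -/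
def specInclusion {k : Type u} [Field k] (A : Subring k) :
    Spec (CommRingCat.of k) ⟶ Spec (CommRingCat.of A) :=
  Spec.map (CommRingCat.ofHom A.subtype)

/-- `f : XA ⟶ Spec A`, together with `g : X ⟶ XA`, is a model over the subring `A` of `k` of the
`k`-scheme `π : X ⟶ Spec k`: it is flat and of finite type, and `g` identifies `X` with the base
change `XA ×_{Spec A} Spec k`. -/
structure IsModel {k : Type u} [Field k] {X : Scheme.{u}} (π : X ⟶ Spec (CommRingCat.of k))
    (A : Subring k) {XA : Scheme.{u}} (f : XA ⟶ Spec (CommRingCat.of A)) (g : X ⟶ XA) :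
    Prop where
  locallyOfFiniteType : LocallyOfFiniteType f
  quasiCompact : QuasiCompact f
  flat : Flat f
  isPullback : IsPullback g π f (specInclusion A)

/-- The conjecture on the action of Frobenius, over the field `k`: for every smooth, connected
`n`-dimensional projective variety `X` over `k`, and every model `XA` of `X` over a subring `A` of
`k` of finite type over `ℤ`, there is a dense set of closed points `s` of `Spec A` such that
Frobenius acts bijectively on `Hⁿ(X_s, 𝒪_{X_s})`. -/
def FrobeniusConjecture (k : Type u) [Field k] : Prop :=
  ∀ (n : ℕ) (X : Scheme.{u}) (π : X ⟶ Spec (CommRingCat.of k)),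
    IsProjective π → SmoothOfRelativeDimension n π → ConnectedSpace X →
    ∀ (A : Subring k), Algebra.FiniteType ℤ A →
    ∀ (XA : Scheme.{u}) (f : XA ⟶ Spec (CommRingCat.of A)) (g : X ⟶ XA), IsModel π A f g →
    ∃ S : Set (Spec (CommRingCat.of A)), Dense S ∧
      ∀ s ∈ S, IsClosed ({s} : Set (Spec (CommRingCat.of A))) ∧ FrobeniusBijectiveOnFiber f s n

end FrobeniusReduction

end

noncomputable section

namespace FrobeniusReduction

/-! ### Invariance of the Frobenius action under isomorphism of schemes -/

open scoped TensorProduct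

/-! The geometric hypotheses on $X$ already hold over a finitely generated ring, and that ring can
be specialized to algebraic numbers. There is a finitely generated $A$-subalgebra $S$ of $k$ such
that, for every $A$-algebra $T$ receiving a map from $S$, the base change of $X_A$ to $T$ is
projective and smooth of relative dimension $n$, and connected when $T$ is a field
(`eventually_isProjective`, `eventually_smoothOfRelativeDimension`, `eventually_connectedSpace`).

For density, a good closed point is needed in $D(b)$ for each nonzero $b \in A$. Since $S$ is a
domain of characteristic zero and of finite type over $\mathbf{Z}$, the ring $\mathbf{Q} \otimes
S[1/b]$ is nonzero, so there is a homomorphism $\psi : S \to \overline{\mathbf{Q}}$ with $\psi(b)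
\neq 0$ (`exists_ringHom_ne_zero`). The assumed conjecture applies to the base change of $X_A$ along
$\psi$, with the restriction of $X_A$ to the image $B$ of $A$ as model. A good point of
$\operatorname{Spec} B$ in $D(b)$ is a closed point of $\operatorname{Spec} A$ with the same residue
field and the same fiber (`FrobeniusConjecture.exists_mem_basicOpen`). It is not required that
$\psi$ be injective on $A$; only $b$ must survive.

Spreading out rests on writing $X_k$ as the limit of the $X_S$. Because `Eventually` quantifies over
all algebras over a stage, its conclusions pass to any specialization. Connectedness is the hard
case. A smooth scheme over $k$ is covered by principal open subsets of irreducible hypersurfaces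
(`exists_hypersurface_chart`). Over an algebraically closed field, irreducibility of a polynomial
says that finitely many systems of equations for the coefficients of factors have no solution; by
the Nullstellensatz this is an identity $1 = 0$ in an algebra over $k$, hence over some stage
(`eventually_irreducible`). So the charts have geometrically irreducible fibers, nonempty overlaps
stay nonempty, and the chains of charts that connect $X_k$ connect the other fibers too. -/

instance isDenseSubsite_opensMap {Y Z : TopCat.{u}} (e : Y ≅ Z) :
    (Opens.map e.hom).IsDenseSubsite (Opens.grothendieckTopology Z)
      (Opens.grothendieckTopology Y) := by
  have : (Opens.map e.hom).IsEquivalence :=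
    inferInstanceAs (Opens.mapMapIso e).functor.IsEquivalence
  refine { functorPushforward_mem_iff := fun {U S} => ?_ }
  have hh : ∀ z : Z, e.hom (e.inv z) = z := fun z => by
    rw [← ConcreteCategory.comp_apply, e.inv_hom_id]; rfl
  have hi : ∀ z : Y, e.inv (e.hom z) = z := fun z => by
    rw [← ConcreteCategory.comp_apply, e.hom_inv_id]; rfl
  constructor
  · intro h z hz
    obtain ⟨V, f, ⟨W, g, k, hg, -⟩, hV⟩ := h (e.inv z) (by
      change e.hom (e.inv z) ∈ U
      rwa [hh])
    refine ⟨W, g, hg, ?_⟩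
    have := k.le hV
    change e.hom (e.inv z) ∈ W at this
    rwa [hh] at this
  · intro h y hy
    obtain ⟨V, f, hf, hV⟩ := h (e.hom y) hy
    exact ⟨(Opens.map e.hom).obj V, (Opens.map e.hom).map f, ⟨V, f, 𝟙 _, hf, by simp⟩, hV⟩

/-- Abelian sheaves on homeomorphic spaces form equivalent categories; the inverse functor is the
pushforward. -/
def sheafEquivOfIso {Y Z : TopCat.{u}} (e : Y ≅ Z) :
    Sheaf (Opens.grothendieckTopology Z) AddCommGrpCat.{u} ≌
      Sheaf (Opens.grothendieckTopology Y) AddCommGrpCat.{u} :=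
  Functor.IsDenseSubsite.sheafEquiv _ _ (Opens.map e.hom) _

/-- The underlying homeomorphism of an isomorphism of schemes. -/
abbrev topIso {Y Z : Scheme.{u}} (e : Y ≅ Z) : Y.toTopCat ≅ Z.toTopCat :=
  Scheme.forgetToTop.mapIso e

/-- The comparison of structure sheaves under an isomorphism of schemes. -/
def structureSheafAbHom {Y Z : Scheme.{u}} (e : Y ≅ Z) :
    structureSheafAb Z ⟶ (sheafEquivOfIso (topIso e)).inverse.obj (structureSheafAb Y) where
  hom :=
    { app := fun U => (forget₂ CommRingCat.{u} RingCat.{u} ⋙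
        forget₂ RingCat.{u} AddCommGrpCat.{u}).map (e.hom.app U.unop)
      naturality := fun U V i => by
        have := congrArg (forget₂ CommRingCat.{u} RingCat.{u} ⋙
          forget₂ RingCat.{u} AddCommGrpCat.{u}).map (e.hom.naturality i)
        rw [Functor.map_comp, Functor.map_comp] at this
        exact this }

theorem isIso_structureSheafAbHom {Y Z : Scheme.{u}} (e : Y ≅ Z) : IsIso (structureSheafAbHom e) := by
  have : ∀ U, IsIso ((structureSheafAbHom e).hom.app U) := fun U => by
    change IsIso ((forget₂ CommRingCat.{u} RingCat.{u} ⋙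
        forget₂ RingCat.{u} AddCommGrpCat.{u}).map (e.hom.app U.unop))
    infer_instance
  have : IsIso (structureSheafAbHom e).hom := NatIso.isIso_of_isIso_app _
  exact (ObjectProperty.isIso_hom_iff _).mp this

/-- Ring homomorphisms commute with $p$-th powers. The structure morphisms serve only to show that
$p$ vanishes, so `π` and `π'` need not be compatible. -/
theorem structureSheafAbHom_frobenius {Y Z : Scheme.{u}} (e : Y ≅ Z) {R R' : CommRingCat.{u}}
    (π : Y ⟶ Spec R) (π' : Z ⟶ Spec R') (p : ℕ) [Fact p.Prime] [CharP R p] [CharP R' p] :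
    structureSheafAbHom e ≫
      (sheafEquivOfIso (topIso e)).inverse.map (frobeniusSheafHom π p) =
      frobeniusSheafHom π' p ≫ structureSheafAbHom e := by
  ext U x
  change Γ(Z, U.unop) at x
  exact (map_pow (e.hom.app U.unop).hom x p).symm

/-- Bijectivity on cohomology can be tested after an equivalence of sheaf categories. -/
theorem bijective_postcomp_iff {C D : Type*} [Category C] [Category D] [Abelian C] [Abelian D]
    [HasExt.{u} C] [HasExt.{u} D] [EnoughInjectives C] (F : C ⥤ D) [F.IsEquivalence] [F.Additive]
    {K X : C} {K' X' : D} (a : K' ≅ F.obj K) (b : X' ≅ F.obj X) (φ : X ⟶ X) (φ' : X' ⟶ X')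
    (h : b.hom ≫ F.map φ = φ' ≫ b.hom) (n : ℕ)
    (hφ : Function.Bijective ((Abelian.Ext.mk₀ φ).postcomp K (add_zero n))) :
    Function.Bijective ((Abelian.Ext.mk₀ φ').postcomp K' (add_zero n)) := by
  -- An equivalence preserves injective objects, and enough injectives exist, so it induces
  -- bijections on `Ext`.
  have hM := F.mapExt_bijective_of_preservesInjectiveObjects K X n
  let T : Abelian.Ext K X n → Abelian.Ext K' X' n := fun x =>
    (Abelian.Ext.mk₀ a.hom).comp ((F.mapExtAddHom K X n x).comp (Abelian.Ext.mk₀ b.inv)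
      (add_zero n)) (zero_add n)
  have hT : Function.Bijective T := by
    refine Function.Bijective.comp (g := fun x : Abelian.Ext (F.obj K) (F.obj X) n =>
      (Abelian.Ext.mk₀ a.hom).comp (x.comp (Abelian.Ext.mk₀ b.inv)
      (add_zero n)) (zero_add n)) ?_ hM
    refine Function.bijective_iff_has_inverse.mpr ⟨fun y => (Abelian.Ext.mk₀ a.inv).comp
      (y.comp (Abelian.Ext.mk₀ b.hom) (add_zero n)) (zero_add n), fun x => ?_, fun y => ?_⟩
    · simp [← Abelian.Ext.comp_assoc_of_third_deg_zero]
    · simp [← Abelian.Ext.comp_assoc_of_third_deg_zero]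
  have hc : ((Abelian.Ext.mk₀ φ').postcomp K' (add_zero n)) ∘ T =
      T ∘ ((Abelian.Ext.mk₀ φ).postcomp K (add_zero n)) := by
    have h' : b.inv ≫ φ' = F.map φ ≫ b.inv := by
      rw [Iso.inv_comp_eq, ← Category.assoc, h, Category.assoc, b.hom_inv_id, Category.comp_id]
    funext x
    simp [T, Abelian.Ext.postcomp, Functor.mapExtAddHom, Abelian.Ext.mapExactFunctor_comp,
      Abelian.Ext.mapExactFunctor_mk₀, Abelian.Ext.comp_assoc_of_third_deg_zero, h']
  have : Function.Bijective (((Abelian.Ext.mk₀ φ').postcomp K' (add_zero n)) ∘ T) := by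
    rw [hc]
    exact hT.comp hφ
  exact (Function.Bijective.of_comp_iff _ hT).mp this

/-- Cohomology is `Ext` out of a constant sheaf. The equivalence of sheaf categories matches the
constant sheaves, the structure sheaves and the two Frobenius maps. -/
theorem bijective_frobeniusCohomology_of_iso {Y Z : Scheme.{u}} (e : Y ≅ Z)
    {R R' : CommRingCat.{u}} (π : Y ⟶ Spec R) (π' : Z ⟶ Spec R') (p : ℕ) [Fact p.Prime]
    [CharP R p] [CharP R' p] (n : ℕ) (h : Function.Bijective (frobeniusCohomology π p n)) :
    Function.Bijective (frobeniusCohomology π' p n) := by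
  have : (sheafEquivOfIso (topIso e)).inverse.Additive :=
    ⟨rfl⟩
  have := isIso_structureSheafAbHom e
  -- The comparison of constant sheaves asks for terminal objects of the two sites that correspond
  -- to each other: the whole spaces.
  have ht : IsTerminal (⊤ : Opens Z) := isTerminalTop
  have ht' : IsTerminal ((Opens.map (topIso e).hom).obj (⊤ : Opens Z)) :=
    (isTerminalTop : IsTerminal (⊤ : Opens Y))
  exact bijective_postcomp_iff (sheafEquivOfIso (topIso e)).inverse
    ((equivCommuteConstant' _ AddCommGrpCat.{u} _ (Opens.map (topIso e).hom) ht ht').app _)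
    (asIso (structureSheafAbHom e)) _ _ (structureSheafAbHom_frobenius e π π' p) n h

/-- A surjective map of residue fields is an isomorphism, so the fibers over `s` and over its image
are isomorphic. -/
theorem FrobeniusBijectiveOnFiber.of_isPullback {X' X S' S : Scheme.{u}} {g' : X' ⟶ X}
    {f' : X' ⟶ S'} {f : X ⟶ S} {g : S' ⟶ S} (hp : IsPullback g' f' f g) (s : S')
    (hs : Function.Surjective (g.residueFieldMap s).hom) {n : ℕ}
    (h : FrobeniusBijectiveOnFiber f' s n) : FrobeniusBijectiveOnFiber f (g s) n := by
  obtain ⟨p, hp1, hp2, hb⟩ := h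
  have : CharP (S.residueField (g s)) p :=
    (RingHom.charP_iff (g.residueFieldMap s).hom (RingHom.injective _) p).mpr hp2
  have hiso : IsIso (g.residueFieldMap s) :=
    (ConcreteCategory.isIso_iff_bijective _).mpr ⟨RingHom.injective _, hs⟩
  have h2 := isPullback_fiberToSpecResidueField_of_isPullback hp s
  have hi := h2.isIso_fst_of_isIso
  exact ⟨p, hp1, this, bijective_frobeniusCohomology_of_iso (@asIso _ _ _ _ _ hi) _ _ p n hb⟩

/-! ### Properties of base changes to sufficiently large finitely generated subalgebras -/

/-- The property `P` of `R`-algebras holds for all algebras over some finitely generated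
`R`-subalgebra of `k`. -/
def Eventually (R k : Type u) [CommRing R] [CommRing k] [Algebra R k]
    (P : ∀ (T : Type u) [CommRing T] [Algebra R T], Prop) : Prop :=
  ∃ S : Subalgebra R k, S.FG ∧ ∀ (T : Type u) [CommRing T] [Algebra R T], (S →ₐ[R] T) → P T

theorem fg_iSup {R k : Type*} [CommRing R] [CommRing k] [Algebra R k] {ι : Type*} [Finite ι]
    {S : ι → Subalgebra R k} (hS : ∀ i, (S i).FG) : (⨆ i, S i).FG := by
  classical
  have := Fintype.ofFinite ι
  have : ∀ s : Finset ι, (⨆ i ∈ s, S i).FG := fun s => by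
    induction s using Finset.cons_induction with
    | empty => simpa using Subalgebra.fg_bot
    | cons a s ha ih =>
      rw [Finset.cons_eq_insert, Finset.iSup_insert]
      exact (hS a).sup ih
  simpa using this Finset.univ

namespace Eventually

variable {R k : Type u} [CommRing R] [CommRing k] [Algebra R k]
  {P Q : ∀ (T : Type u) [CommRing T] [Algebra R T], Prop}

theorem mono (h : Eventually R k P) (H : ∀ (T : Type u) [CommRing T] [Algebra R T], P T → Q T) :
    Eventually R k Q := by
  obtain ⟨S, hS, h⟩ := h
  exact ⟨S, hS, fun T _ _ φ => H T (h T φ)⟩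

theorem and (hP : Eventually R k P) (hQ : Eventually R k Q) :
    Eventually R k (fun T _ _ => P T ∧ Q T) := by
  obtain ⟨S, hS, hP⟩ := hP
  obtain ⟨S', hS', hQ⟩ := hQ
  exact ⟨S ⊔ S', hS.sup hS', fun T _ _ φ =>
    ⟨hP T (φ.comp (Subalgebra.inclusion le_sup_left)),
      hQ T (φ.comp (Subalgebra.inclusion le_sup_right))⟩⟩

theorem forall_finite {ι : Type*} [Finite ι]
    {P : ι → ∀ (T : Type u) [CommRing T] [Algebra R T], Prop} (h : ∀ i, Eventually R k (P i)) :
    Eventually R k (fun T _ _ => ∀ i, P i T) := by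
  choose S hS h using h
  exact ⟨⨆ i, S i, fg_iSup hS, fun T _ _ φ i =>
    h i T (φ.comp (Subalgebra.inclusion (le_iSup S i)))⟩

end Eventually

theorem fg_restrictScalars {R k : Type u} [CommRing R] [CommRing k] [Algebra R k]
    {S : Subalgebra R k} (hS : S.FG) {S' : Subalgebra S k} (hS' : S'.FG) :
    (S'.restrictScalars R).FG := by
  rw [Subalgebra.fg_iff_finiteType] at *
  have : Algebra.FiniteType R S' := Algebra.FiniteType.trans hS hS'
  exact this

/-- Allows the base ring to be enlarged in the middle of an argument: what is finitely generated
over a finitely generated subalgebra is finitely generated over `R`. -/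
theorem Eventually.of_stage {R k : Type u} [CommRing R] [CommRing k] [Algebra R k]
    {S : Subalgebra R k} (hS : S.FG) {P : ∀ (T : Type u) [CommRing T] [Algebra R T], Prop}
    {P' : ∀ (T : Type u) [CommRing T] [Algebra S T], Prop} (h : Eventually S k P')
    (H : ∀ (T : Type u) [CommRing T] [Algebra R T] [Algebra S T] [IsScalarTower R S T],
      P' T → P T) :
    Eventually R k P := by
  obtain ⟨S', hS', h⟩ := h
  refine ⟨S'.restrictScalars R, fg_restrictScalars hS hS', fun T _ _ φ => ?_⟩
  let ψ : S' →+* T := φ.toRingHom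
  let : Algebra S T := (ψ.comp (algebraMap S S')).toAlgebra
  have : IsScalarTower R S T := IsScalarTower.of_algebraMap_eq fun r =>
    (φ.commutes r).symm
  exact H T (h T { ψ with commutes' := fun _ => rfl })

/-! ### Base change of schemes over affine schemes -/

/-- The morphism of spectra induced by the structure map of an algebra. -/
abbrev specMap (R T : Type u) [CommRing R] [CommRing T] [Algebra R T] :
    Spec (CommRingCat.of T) ⟶ Spec (CommRingCat.of R) :=
  Spec.map (CommRingCat.ofHom (algebraMap R T))

/-- The morphism of spectra induced by an algebra homomorphism. -/
abbrev specMapHom {R S T : Type u} [CommRing R] [CommRing S] [CommRing T] [Algebra R S]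
    [Algebra R T] (φ : S →ₐ[R] T) : Spec (CommRingCat.of T) ⟶ Spec (CommRingCat.of S) :=
  Spec.map (CommRingCat.ofHom φ.toRingHom)

theorem specMapHom_specMap {R S T : Type u} [CommRing R] [CommRing S] [CommRing T] [Algebra R S]
    [Algebra R T] (φ : S →ₐ[R] T) : specMapHom φ ≫ specMap R S = specMap R T := by
  rw [← Spec.map_comp, ← CommRingCat.ofHom_comp]
  congr 2
  exact φ.comp_algebraMap

theorem specMapHom_comp {R S T U : Type u} [CommRing R] [CommRing S] [CommRing T] [CommRing U]
    [Algebra R S] [Algebra R T] [Algebra R U] (φ : S →ₐ[R] T) (ψ : T →ₐ[R] U) :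
    specMapHom ψ ≫ specMapHom φ = specMapHom (ψ.comp φ) := by
  rw [← Spec.map_comp, ← CommRingCat.ofHom_comp]
  rfl

theorem specMap_specMap (R S T : Type u) [CommRing R] [CommRing S] [CommRing T] [Algebra R S]
    [Algebra R T] [Algebra S T] [IsScalarTower R S T] :
    specMap S T ≫ specMap R S = specMap R T :=
  specMapHom_specMap (IsScalarTower.toAlgHom R S T)

section

variable {R : Type u} [CommRing R] {X : Scheme.{u}} (f : X ⟶ Spec (CommRingCat.of R))

/-- The base change of an `R`-scheme to an `R`-algebra. -/
abbrev bc (T : Type u) [CommRing T] [Algebra R T] : Scheme.{u} := pullback f (specMap R T)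

/-- The structure morphism of the base change. -/
abbrev bcTo (T : Type u) [CommRing T] [Algebra R T] : bc f T ⟶ Spec (CommRingCat.of T) :=
  pullback.snd f (specMap R T)

/-- The projection of the base change. -/
abbrev bcFst (T : Type u) [CommRing T] [Algebra R T] : bc f T ⟶ X :=
  pullback.fst f (specMap R T)

/-- Functoriality of the base change in the algebra. -/
def bcMap {S T : Type u} [CommRing S] [CommRing T] [Algebra R S] [Algebra R T] (φ : S →ₐ[R] T) :
    bc f T ⟶ bc f S :=
  pullback.lift (bcFst f T) (bcTo f T ≫ specMapHom φ) (by
    rw [Category.assoc, specMapHom_specMap, pullback.condition])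

variable {S T U : Type u} [CommRing S] [CommRing T] [CommRing U] [Algebra R S] [Algebra R T]
  [Algebra R U]

@[simp]
theorem bcMap_fst (φ : S →ₐ[R] T) : bcMap f φ ≫ bcFst f S = bcFst f T :=
  pullback.lift_fst _ _ _

@[simp]
theorem bcMap_fst_assoc (φ : S →ₐ[R] T) {Z : Scheme.{u}} (t : X ⟶ Z) :
    bcMap f φ ≫ bcFst f S ≫ t = bcFst f T ≫ t := by
  rw [← Category.assoc, bcMap_fst]

@[simp]
theorem bcMap_snd (φ : S →ₐ[R] T) : bcMap f φ ≫ bcTo f S = bcTo f T ≫ specMapHom φ :=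
  pullback.lift_snd _ _ _

@[simp]
theorem bcMap_snd_assoc (φ : S →ₐ[R] T) {Z : Scheme.{u}} (t : Spec (CommRingCat.of S) ⟶ Z) :
    bcMap f φ ≫ bcTo f S ≫ t = bcTo f T ≫ specMapHom φ ≫ t := by
  rw [← Category.assoc, bcMap_snd, Category.assoc]

theorem bcMap_comp (φ : S →ₐ[R] T) (ψ : T →ₐ[R] U) :
    bcMap f ψ ≫ bcMap f φ = bcMap f (ψ.comp φ) := by
  apply pullback.hom_ext
  · simp
  · simp [specMapHom_comp]

theorem bcMap_id : bcMap f (AlgHom.id R T) = 𝟙 _ := by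
  apply pullback.hom_ext
  · simp
  · simp only [bcMap_snd, Category.id_comp]
    change _ ≫ Spec.map (𝟙 _) = _
    rw [Spec.map_id, Category.comp_id]

theorem isPullback_bcMap (φ : S →ₐ[R] T) :
    IsPullback (bcMap f φ) (bcTo f T) (bcTo f S) (specMapHom φ) := by
  refine IsPullback.of_right (h₁₂ := bcFst f S) (h₂₂ := specMap R S) (v₁₃ := f) ?_
    (bcMap_snd f φ) (IsPullback.of_hasPullback f (specMap R S))
  rw [bcMap_fst, specMapHom_specMap]
  exact IsPullback.of_hasPullback f (specMap R T)

instance (φ : S →ₐ[R] T) : IsAffineHom (bcMap f φ) :=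
  MorphismProperty.of_isPullback (isPullback_bcMap f φ).flip
    (inferInstance : IsAffineHom (specMapHom φ))

end

/-! ### The limit over finitely generated subalgebras -/

section Limit

variable (R k : Type u) [CommRing R] [CommRing k] [Algebra R k]

/-- The finitely generated subalgebras of an algebra. -/
abbrev FGSubalgebra : Type u := {S : Subalgebra R k // S.FG}

instance : Nonempty (FGSubalgebra R k) := ⟨⟨⊥, Subalgebra.fg_bot⟩⟩

instance : IsDirectedOrder (FGSubalgebra R k) :=
  ⟨fun S S' => ⟨⟨S.1 ⊔ S'.1, S.2.sup S'.2⟩, show S.1 ≤ _ from le_sup_left, show S'.1 ≤ _ from le_sup_right⟩⟩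

/-- The diagram of finitely generated subalgebras. -/
def fgDiagram : FGSubalgebra R k ⥤ CommRingCat.{u} where
  obj S := CommRingCat.of S.1
  map f := CommRingCat.ofHom (Subalgebra.inclusion f.le).toRingHom

/-- An algebra as a cocone over its finitely generated subalgebras. -/
def fgCocone : Cocone (fgDiagram R k) where
  pt := CommRingCat.of k
  ι := { app := fun S => CommRingCat.ofHom S.1.val.toRingHom }

/-- An algebra is the colimit of its finitely generated subalgebras. -/
def isColimitFgCocone : IsColimit (fgCocone R k) := by
  have : ReflectsColimit (fgDiagram R k) (forget CommRingCat.{u}) :=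
    reflectsColimit_of_reflectsIsomorphisms _ _
  refine isColimitOfReflects (forget CommRingCat.{u}) (Types.FilteredColimit.isColimitOf' _ _ ?_ ?_)
  · intro (x : k)
    exact ⟨⟨Algebra.adjoin R {x}, ⟨{x}, by simp⟩⟩,
      ⟨x, Algebra.self_mem_adjoin_singleton R x⟩, rfl⟩
  · intro S x y h
    exact ⟨S, 𝟙 _, congrArg _ (Subtype.ext h)⟩

/-- The diagram of spectra of finitely generated subalgebras has the spectrum as limit. -/
def isLimitSpecCone : IsLimit (Scheme.Spec.mapCone (fgCocone R k).op) :=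
  isLimitOfPreserves _ (isColimitFgCocone R k).op

variable {R}
variable {X : Scheme.{u}} (f : X ⟶ Spec (CommRingCat.of R))

/-- The diagram of base changes to finitely generated subalgebras. -/
def bcDiagram : (FGSubalgebra R k)ᵒᵖ ⥤ Scheme.{u} where
  obj S := bc f S.unop.1
  map φ := bcMap f (Subalgebra.inclusion φ.unop.le)
  map_id S := by
    have : Subalgebra.inclusion (le_refl S.unop.1) = AlgHom.id R _ := by ext; rfl
    exact (congrArg (bcMap f) this).trans (bcMap_id f)
  map_comp {S S' S''} φ ψ := by
    have : Subalgebra.inclusion (φ ≫ ψ).unop.le = (Subalgebra.inclusion φ.unop.le).comp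
      (Subalgebra.inclusion ψ.unop.le) := by ext; rfl
    exact (congrArg (bcMap f) this).trans (bcMap_comp f _ _).symm

/-- The base change to an algebra, as a cone over the base changes to finitely generated
subalgebras. -/
def bcCone : Cone (bcDiagram k f) where
  pt := bc f k
  π :=
    { app := fun S => bcMap f S.unop.1.val
      naturality := fun S _ φ => (Category.id_comp _).trans
        (bcMap_comp f (Subalgebra.inclusion φ.unop.le) S.unop.1.val).symm }

/-- The base change to an algebra is the limit of the base changes to finitely generated
subalgebras. -/
def isLimitBcCone : IsLimit (bcCone k f) := by
  have hw (s : Cone (bcDiagram k f)) {S S' : (FGSubalgebra R k)ᵒᵖ} (φ : S ⟶ S') :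
      s.π.app S ≫ bcMap f (Subalgebra.inclusion φ.unop.le) = s.π.app S' := s.w φ
  let t (s : Cone (bcDiagram k f)) : Cone ((fgDiagram R k).op ⋙ Scheme.Spec) :=
    { pt := s.pt
      π :=
        { app := fun S => s.π.app S ≫ bcTo f S.unop.1
          naturality := fun S S' φ => by
            refine (Category.id_comp _).trans ?_
            rw [← hw s φ]
            exact (Category.assoc _ _ _).trans ((congrArg (s.π.app S ≫ ·) (bcMap_snd f _)).trans
              (Category.assoc _ _ _).symm) } }
  let l (s : Cone (bcDiagram k f)) : s.pt ⟶ Spec (CommRingCat.of k) :=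
    (isLimitSpecCone R k).lift (t s)
  have ht (s : Cone (bcDiagram k f)) (S : (FGSubalgebra R k)ᵒᵖ) : l s ≫
      specMapHom S.unop.1.val = s.π.app S ≫ bcTo f S.unop.1 :=
    (isLimitSpecCone R k).fac (t s) S
  -- The bottom subalgebra lies below every stage, so all the projections of a cone to `X` agree
  -- with the one at this stage.
  let S₀ : (FGSubalgebra R k)ᵒᵖ := op ⟨⊥, Subalgebra.fg_bot⟩
  have hS (s : Cone (bcDiagram k f)) (S) : s.π.app S ≫ bcFst f S.unop.1 =
      s.π.app S₀ ≫ bcFst f S₀.unop.1 := by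
    rw [← hw s (homOfLE (show S₀.unop.1 ≤ S.unop.1 from bot_le) : S₀.unop ⟶ S.unop).op]
    exact ((Category.assoc _ _ _).trans (congrArg (s.π.app S ≫ ·) (bcMap_fst f _))).symm
  have hl (s : Cone (bcDiagram k f)) : (s.π.app S₀ ≫ bcFst f S₀.unop.1) ≫ f =
      l s ≫ specMap R k := by
    have h1 : l s ≫ specMap R k = (l s ≫ specMapHom S₀.unop.1.val) ≫ specMap R S₀.unop.1 := by
      rw [Category.assoc, specMapHom_specMap]
    rw [h1, ht]
    exact (Category.assoc _ _ _).trans ((congrArg (s.π.app S₀ ≫ ·) pullback.condition).trans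
      (Category.assoc _ _ _).symm)
  refine ⟨fun s => pullback.lift _ _ (hl s), fun s S => ?_,
    fun s (m : s.pt ⟶ bc f k) hm => ?_⟩
  · apply pullback.hom_ext
    · refine (Category.assoc _ _ _).trans ((congrArg (pullback.lift _ _ (hl s) ≫ ·)
        (bcMap_fst f _)).trans ((pullback.lift_fst _ _ _).trans (hS s S).symm))
    · refine (Category.assoc _ _ _).trans ((congrArg (pullback.lift _ _ (hl s) ≫ ·)
        (bcMap_snd f _)).trans (((Category.assoc _ _ _).symm.trans
          (congrArg (· ≫ _) (pullback.lift_snd _ _ _))).trans (ht s S)))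
  · have hm' (S) : m ≫ bcMap f S.unop.1.val = s.π.app S := hm S
    apply pullback.hom_ext
    · refine Eq.trans ?_ (pullback.lift_fst _ _ _).symm
      rw [← hm' S₀]
      exact ((Category.assoc _ _ _).trans (congrArg (m ≫ ·) (bcMap_fst f _))).symm
    · refine Eq.trans ?_ (pullback.lift_snd _ _ _).symm
      refine (isLimitSpecCone R k).hom_ext fun S => Eq.trans ?_ (ht s S).symm
      rw [← hm' S]
      exact (Category.assoc _ _ _).trans ((congrArg (m ≫ ·) (bcMap_snd f _).symm).trans
        (Category.assoc _ _ _).symm)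

instance {S S' : (FGSubalgebra R k)ᵒᵖ} (φ : S ⟶ S') : IsAffineHom ((bcDiagram k f).map φ) :=
  inferInstanceAs (IsAffineHom (bcMap f _))

instance [QuasiCompact f] (T : Type u) [CommRing T] [Algebra R T] : CompactSpace (bc f T) :=
  QuasiCompact.compactSpace_of_compactSpace (bcTo f T)

instance [QuasiSeparated f] (T : Type u) [CommRing T] [Algebra R T] :
    QuasiSeparatedSpace (bc f T) :=
  quasiSeparatedSpace_of_quasiSeparated (bcTo f T)

instance [QuasiCompact f] (S : (FGSubalgebra R k)ᵒᵖ) : CompactSpace ((bcDiagram k f).obj S) :=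
  inferInstanceAs (CompactSpace (bc f _))

instance [QuasiSeparated f] (S : (FGSubalgebra R k)ᵒᵖ) :
    QuasiSeparatedSpace ((bcDiagram k f).obj S) :=
  inferInstanceAs (QuasiSeparatedSpace (bc f _))

variable {k} {f}

/-- The constant morphism from the diagram of base changes induced by a morphism. -/
def bcDiagramTo (k : Type u) [CommRing k] [Algebra R k] (f : X ⟶ Spec (CommRingCat.of R))
    {Z : Scheme.{u}} (u : X ⟶ Z) : bcDiagram k f ⟶ (Functor.const _).obj Z where
  app S := bcFst f S.unop.1 ≫ u
  naturality _ _ φ :=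
    (bcMap_fst_assoc f (Subalgebra.inclusion φ.unop.le) u).trans (Category.comp_id _).symm

/-- A morphism from a limit with affine transition maps to a target of finite presentation factors
through a stage. The base `Z` is left free so that it can be `Spec R` or the terminal scheme. -/
theorem exists_spread_hom [QuasiCompact f] [QuasiSeparated f] {Y Z : Scheme.{u}} (h : Y ⟶ Z)
    [LocallyOfFinitePresentation h] (u : X ⟶ Z) (a : bc f k ⟶ Y) (ha : a ≫ h = bcFst f k ≫ u) :
    ∃ S : Subalgebra R k, S.FG ∧ ∃ g : bc f S ⟶ Y, g ≫ h = bcFst f S ≫ u ∧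
      bcMap f S.val ≫ g = a := by
  obtain ⟨S, g, hg, hg'⟩ := Scheme.exists_π_app_comp_eq_of_locallyOfFinitePresentation
    (bcDiagram k f) (bcDiagramTo k f u) h (bcCone k f) (isLimitBcCone k f) a (by
      ext S : 2
      exact (bcMap_fst_assoc f _ u).trans ha.symm)
  exact ⟨S.unop.1, S.unop.2, g, hg', hg⟩

theorem exists_spread_eq [QuasiCompact f] {Y Z : Scheme.{u}} (h : Y ⟶ Z)
    [LocallyOfFiniteType h] (u : X ⟶ Z) {S : Subalgebra R k} (hS : S.FG) (a b : bc f S ⟶ Y)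
    (ha : a ≫ h = bcFst f S ≫ u) (hb : b ≫ h = bcFst f S ≫ u)
    (hab : bcMap f S.val ≫ a = bcMap f S.val ≫ b) :
    ∃ (S' : Subalgebra R k) (hS' : S ≤ S'), S'.FG ∧
      bcMap f (Subalgebra.inclusion hS') ≫ a = bcMap f (Subalgebra.inclusion hS') ≫ b := by
  obtain ⟨S', i, h'⟩ := Scheme.exists_hom_comp_eq_comp_of_locallyOfFiniteType
    (bcDiagram k f) (bcDiagramTo k f u) h (bcCone k f) (isLimitBcCone k f) (i := op ⟨S, hS⟩) a b ha.symm hb.symm hab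
  exact ⟨S'.unop.1, i.unop.le, S'.unop.2, h'⟩

theorem exists_spread_opens (U : (bc f k).Opens) (hU : IsCompact (U : Set (bc f k))) :
    ∃ S : Subalgebra R k, S.FG ∧ ∃ V : (bc f S).Opens, IsCompact (V : Set (bc f S)) ∧
      bcMap f S.val ⁻¹ᵁ V = U := by
  obtain ⟨S, V, hV, h⟩ := exists_preimage_eq _ _ (isLimitBcCone k f) U hU
  exact ⟨S.unop.1, S.unop.2, V, hV, h⟩

/-- Otherwise the closed complements would be nonempty at all later stages, and so would their
limit. -/
theorem exists_spread_eq_top [QuasiCompact f] {S : Subalgebra R k} (hS : S.FG) (U : (bc f S).Opens)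
    (hU : bcMap f S.val ⁻¹ᵁ U = ⊤) :
    ∃ (S' : Subalgebra R k) (hS' : S ≤ S'), S'.FG ∧
      bcMap f (Subalgebra.inclusion hS') ⁻¹ᵁ U = ⊤ := by
  obtain ⟨S', i, h⟩ := exists_map_eq_top _ _ (isLimitBcCone k f) (i := op ⟨S, hS⟩) U hU
  exact ⟨S'.unop.1, i.unop.le, S'.unop.2, h⟩

theorem exists_spread_isAffine [QuasiCompact f] [QuasiSeparated f] [IsAffine (bc f k)] :
    ∃ S : Subalgebra R k, S.FG ∧ IsAffine (bc f S) := by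
  have : IsAffine (bcCone k f).pt := ‹IsAffine (bc f k)›
  obtain ⟨S, h⟩ := Scheme.exists_isAffine_of_isLimit _ _ (isLimitBcCone k f)
  exact ⟨S.unop.1, S.unop.2, h⟩

end Limit

/-! ### Spreading out isomorphisms -/

/-- Evaluates the property at the stage itself, regarded as a larger `R`-subalgebra of `k`. -/
theorem Eventually.exists_stage {R k : Type u} [CommRing R] [CommRing k] [Algebra R k]
    {S : Subalgebra R k} (hS : S.FG) {P : ∀ (T : Type u) [CommRing T] [Algebra S T], Prop}
    (h : Eventually S k P) :
    ∃ (S' : Subalgebra R k) (hS' : S ≤ S'), S'.FG ∧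
      @P S' _ (Subalgebra.inclusion hS').toRingHom.toAlgebra := by
  obtain ⟨S', hS', h⟩ := h
  have hle : S ≤ S'.restrictScalars R := fun s hs => S'.algebraMap_mem (⟨s, hs⟩ : S)
  refine ⟨S'.restrictScalars R, hle, fg_restrictScalars hS hS', ?_⟩
  let := (Subalgebra.inclusion hle).toRingHom.toAlgebra
  exact h (S'.restrictScalars R)
    { toFun := fun x => ⟨x.1, x.2⟩
      map_one' := rfl
      map_mul' := fun _ _ => rfl
      map_zero' := rfl
      map_add' := fun _ _ => rfl
      commutes' := fun _ => rfl }

section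

variable {R : Type u} [CommRing R] {X Y : Scheme.{u}} {f : X ⟶ Spec (CommRingCat.of R)}
  {h : Y ⟶ Spec (CommRingCat.of R)}

/-- A morphism over `R` from a base change extends to base changes. -/
def bcLift {S T : Type u} [CommRing S] [CommRing T] [Algebra R S] [Algebra R T]
    (g : bc f S ⟶ Y) (hg : g ≫ h = bcFst f S ≫ f) (φ : S →ₐ[R] T) : bc f T ⟶ bc h T :=
  pullback.lift (bcMap f φ ≫ g) (bcTo f T) (by
    rw [Category.assoc, hg, bcMap_fst_assoc, pullback.condition])

@[simp]
theorem bcLift_fst {S T : Type u} [CommRing S] [CommRing T] [Algebra R S] [Algebra R T]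
    (g : bc f S ⟶ Y) (hg : g ≫ h = bcFst f S ≫ f) (φ : S →ₐ[R] T) :
    bcLift g hg φ ≫ bcFst h T = bcMap f φ ≫ g :=
  pullback.lift_fst _ _ _

@[simp]
theorem bcLift_fst_assoc {S T : Type u} [CommRing S] [CommRing T] [Algebra R S] [Algebra R T]
    (g : bc f S ⟶ Y) (hg : g ≫ h = bcFst f S ≫ f) (φ : S →ₐ[R] T) {Z : Scheme.{u}}
    (t : Y ⟶ Z) : bcLift g hg φ ≫ bcFst h T ≫ t = bcMap f φ ≫ g ≫ t := by
  rw [← Category.assoc, bcLift_fst, Category.assoc]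

@[simp]
theorem bcLift_snd {S T : Type u} [CommRing S] [CommRing T] [Algebra R S] [Algebra R T]
    (g : bc f S ⟶ Y) (hg : g ≫ h = bcFst f S ≫ f) (φ : S →ₐ[R] T) :
    bcLift g hg φ ≫ bcTo h T = bcTo f T :=
  pullback.lift_snd _ _ _

@[simp]
theorem bcLift_snd_assoc {S T : Type u} [CommRing S] [CommRing T] [Algebra R S] [Algebra R T]
    (g : bc f S ⟶ Y) (hg : g ≫ h = bcFst f S ≫ f) (φ : S →ₐ[R] T) {Z : Scheme.{u}}
    (t : Spec (CommRingCat.of T) ⟶ Z) : bcLift g hg φ ≫ bcTo h T ≫ t = bcTo f T ≫ t := by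
  rw [← Category.assoc, bcLift_snd]

theorem bcLift_bcMap {S T U : Type u} [CommRing S] [CommRing T] [CommRing U] [Algebra R S]
    [Algebra R T] [Algebra R U] (g : bc f S ⟶ Y) (hg : g ≫ h = bcFst f S ≫ f) (φ : S →ₐ[R] T)
    (ψ : T →ₐ[R] U) :
    bcLift g hg (ψ.comp φ) ≫ bcMap h ψ = bcMap f ψ ≫ bcLift g hg φ := by
  apply pullback.hom_ext
  · simp [← bcMap_comp]
  · simp

/-- If two morphisms become inverse to each other on one side over an algebra, then they do so over
a finitely generated subalgebra. -/
theorem eventually_bcLift_comp_eq_id {k : Type u} [CommRing k] [Algebra R k] [QuasiCompact f]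
    [LocallyOfFiniteType f] {S : Subalgebra R k} (hS : S.FG) (g : bc f S ⟶ Y)
    (hg : g ≫ h = bcFst f S ≫ f) (g' : bc h S ⟶ X) (hg' : g' ≫ f = bcFst h S ≫ h)
    (H : bcLift g hg S.val ≫ bcMap h S.val ≫ g' = bcFst f k) :
    ∃ (S' : Subalgebra R k) (hS' : S ≤ S'), S'.FG ∧ ∀ (T : Type u) [CommRing T] [Algebra R T]
      (φ : S' →ₐ[R] T), bcLift g hg (φ.comp (Subalgebra.inclusion hS')) ≫
        bcLift g' hg' (φ.comp (Subalgebra.inclusion hS')) = 𝟙 _ := by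
  obtain ⟨S', hS', hfg, h'⟩ := exists_spread_eq f f hS (bcLift g hg (AlgHom.id R S) ≫ g')
    (bcFst f S) (by simp [hg', hg, bcMap_id]) rfl (by
      rw [bcMap_fst, ← H, ← Category.assoc, ← Category.assoc]
      congr 1
      exact (bcLift_bcMap g hg _ _).symm)
  refine ⟨S', hS', hfg, fun T _ _ φ => ?_⟩
  -- Only the component to `X` carries information; the component to `Spec T` is the structure
  -- morphism on both sides.
  apply pullback.hom_ext
  · have := bcLift_bcMap g hg (AlgHom.id R S) (φ.comp (Subalgebra.inclusion hS'))
    rw [Category.assoc, bcLift_fst, ← Category.assoc]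
    erw [this]
    rw [← bcMap_comp, Category.assoc, Category.assoc, h']
    simp
  · simp

/-- Two schemes of finite presentation with a common base change become isomorphic over a finitely
generated subalgebra. -/
theorem eventually_iso {k : Type u} [CommRing k] [Algebra R k] [QuasiCompact f]
    [QuasiSeparated f] [LocallyOfFinitePresentation f] [QuasiCompact h] [QuasiSeparated h]
    [LocallyOfFinitePresentation h] {Z : Scheme.{u}} {p : Z ⟶ X} {q : Z ⟶ Y}
    {r : Z ⟶ Spec (CommRingCat.of k)} (hp : IsPullback p r f (specMap R k))
    (hq : IsPullback q r h (specMap R k)) :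
    Eventually R k (fun T _ _ => ∃ e : bc f T ≅ bc h T, e.hom ≫ bcTo h T = bcTo f T) := by
  let i : bc f k ≅ Z := hp.isoPullback.symm
  let j : bc h k ≅ Z := hq.isoPullback.symm
  have hip : i.hom ≫ p = bcFst f k := hp.isoPullback_inv_fst
  have hir : i.hom ≫ r = bcTo f k := hp.isoPullback_inv_snd
  have hjq : j.hom ≫ q = bcFst h k := hq.isoPullback_inv_fst
  have hjr : j.hom ≫ r = bcTo h k := hq.isoPullback_inv_snd
  -- Each of the two projections of `Z` is a morphism over `R` from a base change to `k`, hence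
  -- comes from a finite stage.
  obtain ⟨S₁, hS₁, g₁, hg₁, hk₁⟩ := exists_spread_hom h f (i.hom ≫ q) (by
    rw [Category.assoc, hq.w, ← hp.w, ← Category.assoc, hip])
  obtain ⟨S₂, hS₂, g₂, hg₂, hk₂⟩ := exists_spread_hom f h (j.hom ≫ p) (by
    rw [Category.assoc, hp.w, ← hq.w, ← Category.assoc, hjq])
  let S := S₁ ⊔ S₂
  have hS : S.FG := hS₁.sup hS₂
  let g := bcMap f (Subalgebra.inclusion (le_sup_left : S₁ ≤ S)) ≫ g₁
  let g' := bcMap h (Subalgebra.inclusion (le_sup_right : S₂ ≤ S)) ≫ g₂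
  have hg : g ≫ h = bcFst f S ≫ f := by simp [g, hg₁]
  have hg' : g' ≫ f = bcFst h S ≫ h := by simp [g', hg₂]
  have hk : bcMap f S.val ≫ g = i.hom ≫ q := by
    rw [← hk₁, ← Category.assoc, bcMap_comp]
    rfl
  have hk' : bcMap h S.val ≫ g' = j.hom ≫ p := by
    rw [← hk₂, ← Category.assoc, bcMap_comp]
    rfl
  -- Over `k` the two morphisms become the comparison isomorphisms through `Z`, which are inverse to
  -- each other; this persists at a finite stage.
  have e₁ : bcLift g hg S.val = i.hom ≫ j.inv := by
    rw [Iso.eq_comp_inv]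
    apply hq.hom_ext
    · rw [Category.assoc, hjq, bcLift_fst, hk]
    · rw [Category.assoc, hjr, bcLift_snd, hir]
  have e₂ : bcLift g' hg' S.val = j.hom ≫ i.inv := by
    rw [Iso.eq_comp_inv]
    apply hp.hom_ext
    · rw [Category.assoc, hip, bcLift_fst, hk']
    · rw [Category.assoc, hir, bcLift_snd, hjr]
  obtain ⟨S₃, hS₃, hf₃, h₃⟩ := eventually_bcLift_comp_eq_id hS g hg g' hg' (by
    rw [hk', e₁]
    simpa using hip)
  obtain ⟨S₄, hS₄, hf₄, h₄⟩ := eventually_bcLift_comp_eq_id hS g' hg' g hg (by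
    rw [hk, e₂]
    simpa using hjq)
  refine ⟨S₃ ⊔ S₄, hf₃.sup hf₄, fun T _ _ φ => ?_⟩
  have h₅ := h₃ T (φ.comp (Subalgebra.inclusion le_sup_left))
  have h₆ := h₄ T (φ.comp (Subalgebra.inclusion le_sup_right))
  exact ⟨⟨_, _, h₅, h₆⟩, bcLift_snd g hg _⟩

/-! ### Spreading out properties which hold locally -/

theorem isPullback_opens_bcMap {S T : Type u} [CommRing S] [CommRing T] [Algebra R S]
    [Algebra R T] (φ : S →ₐ[R] T) (V : (bc f S).Opens) :
    IsPullback (bcMap f φ ∣_ V) ((bcMap f φ ⁻¹ᵁ V).ι ≫ bcTo f T) (V.ι ≫ bcTo f S)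
      (specMapHom φ) :=
  (isPullback_morphismRestrict (bcMap f φ) V).paste_vert (isPullback_bcMap f φ)

/-- The open set `U` has two finitely presented models, an open subset of a stage of `X` and the
given `Y`. They become isomorphic at a later stage, and `Q` passes from the second to the first by
base change. -/
theorem exists_spread_of_isPullback {k : Type u} [CommRing k] [Algebra R k]
    [QuasiCompact f] [QuasiSeparated f] [LocallyOfFinitePresentation f]
    (Q : MorphismProperty Scheme.{u}) [Q.IsStableUnderBaseChange] (U : (bc f k).Opens)
    (hU : IsCompact (U : Set (bc f k))) {S : Subalgebra R k} (hS : S.FG)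
    {g : Y ⟶ Spec (CommRingCat.of S)} [QuasiCompact g] [QuasiSeparated g]
    [LocallyOfFinitePresentation g] (hg : Q g) {q : (U : Scheme.{u}) ⟶ Y}
    (hq : IsPullback q (U.ι ≫ bcTo f k) g (specMap S k)) :
    ∃ S' : Subalgebra R k, S'.FG ∧ ∃ V : (bc f S').Opens, bcMap f S'.val ⁻¹ᵁ V = U ∧
      Q (V.ι ≫ bcTo f S') := by
  obtain ⟨S₁, hS₁, V₁, hV₁, rfl⟩ := exists_spread_opens U hU
  let S₂ := S ⊔ S₁
  have hS₂ : S₂.FG := hS.sup hS₁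
  let ι : S₁ →ₐ[R] S₂ := Subalgebra.inclusion le_sup_right
  let j : S →ₐ[R] S₂ := Subalgebra.inclusion le_sup_left
  let := j.toRingHom.toAlgebra
  have : IsScalarTower S S₂ k := IsScalarTower.of_algebraMap_eq fun _ => rfl
  let V₂ := bcMap f ι ⁻¹ᵁ V₁
  have hV₂ : IsCompact (V₂ : Set (bc f S₂)) := (bcMap f ι).isCompact_preimage hV₁
  have hV₂' : bcMap f S₂.val ⁻¹ᵁ V₂ = bcMap f S₁.val ⁻¹ᵁ V₁ := by
    rw [← Scheme.Hom.comp_preimage, bcMap_comp]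
    rfl
  -- From here on `U` is the preimage of `V₂` at the common stage, instead of the preimage of `V₁`.
  generalize hUU : bcMap f S₁.val ⁻¹ᵁ V₁ = U at *
  subst hV₂'
  have : CompactSpace V₂ := isCompact_iff_compactSpace.mp hV₂
  have : QuasiCompact (V₂.ι ≫ bcTo f S₂) := (quasiCompact_iff_compactSpace _).mpr ‹_›
  have : QuasiSeparated (V₂.ι ≫ bcTo f S₂) := inferInstance
  have : LocallyOfFinitePresentation (V₂.ι ≫ bcTo f S₂) := inferInstance
  have p₁ : IsPullback (bcMap f S₂.val ∣_ V₂) ((bcMap f S₂.val ⁻¹ᵁ V₂).ι ≫ bcTo f k)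
      (V₂.ι ≫ bcTo f S₂) (specMap S₂ k) := isPullback_opens_bcMap S₂.val V₂
  let q' : (bcMap f S₂.val ⁻¹ᵁ V₂ : Scheme.{u}) ⟶ bc g S₂ :=
    pullback.lift q (((bcMap f S₂.val ⁻¹ᵁ V₂).ι ≫ bcTo f k) ≫ specMap S₂ k) (by
      rw [hq.w, Category.assoc, Category.assoc, Category.assoc, specMap_specMap])
  have p₂ : IsPullback q' ((bcMap f S₂.val ⁻¹ᵁ V₂).ι ≫ bcTo f k) (bcTo g S₂) (specMap S₂ k) := by
    refine IsPullback.of_right (h₁₂ := bcFst g S₂) (h₂₂ := specMap S S₂) (v₁₃ := g) ?_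
      (pullback.lift_snd _ _ _) (IsPullback.of_hasPullback _ _)
    rw [specMap_specMap]
    convert hq
    exact pullback.lift_fst _ _ _
  obtain ⟨S₃, hS₃, hf₃, e, he⟩ := (eventually_iso p₁ p₂).exists_stage hS₂
  let := (Subalgebra.inclusion hS₃).toRingHom.toAlgebra
  refine ⟨S₃, hf₃, bcMap f (Subalgebra.inclusion hS₃) ⁻¹ᵁ V₂, ?_, ?_⟩
  · rw [← Scheme.Hom.comp_preimage, bcMap_comp]
    rfl
  · have p₃ := isPullback_opens_bcMap (Subalgebra.inclusion hS₃) V₂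
    let i := p₃.isoPullback ≪≫ e
    have hi : i.hom ≫ bcTo (bcTo g S₂) S₃ = 
        (bcMap f (Subalgebra.inclusion hS₃) ⁻¹ᵁ V₂).ι ≫ bcTo f S₃ := by
      refine (Category.assoc _ _ _).trans ((congrArg (_ ≫ ·) he).trans ?_)
      exact p₃.isoPullback_hom_snd
    rw [← hi, Q.cancel_left_of_respectsIso]
    exact Q.pullback_snd _ _ (Q.pullback_snd _ _ hg)

/-- If locally on the base change to `k`, a family of properties is satisfied by finitely presented
descents, then some finitely generated subalgebra has a finite open cover with this property. -/
theorem exists_spread_cover {k : Type u} [CommRing k] [Algebra R k]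
    [QuasiCompact f] (Q : MorphismProperty Scheme.{u}) [Q.IsStableUnderBaseChange]
    (H : ∀ x : bc f k, ∃ S : Subalgebra R k, S.FG ∧ ∃ V : (bc f S).Opens,
      x ∈ bcMap f S.val ⁻¹ᵁ V ∧ Q (V.ι ≫ bcTo f S)) :
    ∃ S : Subalgebra R k, S.FG ∧ ∃ (m : ℕ) (V : Fin m → (bc f S).Opens), ⨆ i, V i = ⊤ ∧
      ∀ i, Q ((V i).ι ≫ bcTo f S) := by
  choose S hS V hx hV using H
  obtain ⟨t, ht⟩ := (CompactSpace.isCompact_univ (X := bc f k)).elim_finite_subcover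
    (fun x => (bcMap f (S x).val ⁻¹ᵁ V x : Set (bc f k)))
    (fun x => (bcMap f (S x).val ⁻¹ᵁ V x).isOpen) (fun x _ => Set.mem_iUnion.mpr ⟨x, hx x⟩)
  let e := t.equivFin.symm
  let S₁ : Subalgebra R k := ⨆ i, S (e i).1
  have hS₁ : S₁.FG := fg_iSup fun i => hS _
  let φ (i) : S (e i).1 →ₐ[R] S₁ := Subalgebra.inclusion (le_iSup (fun i => S (e i).1) i)
  -- Finitely many of the opens cover over `k`, so their union becomes everything at a finite stage.
  obtain ⟨S₂, hS₂, hf₂, h₂⟩ := exists_spread_eq_top hS₁ (⨆ i, bcMap f (φ i) ⁻¹ᵁ V (e i).1) (by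
    refine eq_top_iff.mpr fun (x : bc f k) _ => ?_
    obtain ⟨y, hy, hxy⟩ := Set.mem_iUnion₂.mp (ht (Set.mem_univ x))
    change bcMap f S₁.val x ∈ (⨆ i, bcMap f (φ i) ⁻¹ᵁ V (e i).1 : (bc f S₁).Opens)
    rw [Opens.mem_iSup]
    refine ⟨e.symm ⟨y, hy⟩, ?_⟩
    rw [← Scheme.Hom.mem_preimage, ← Scheme.Hom.comp_preimage, bcMap_comp]
    have : x ∈ bcMap f (S (e (e.symm ⟨y, hy⟩))).val ⁻¹ᵁ V (e (e.symm ⟨y, hy⟩)) := by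
      rw [e.apply_symm_apply]
      exact hxy
    exact this)
  let ψ (i) : S (e i).1 →ₐ[R] S₂ := (Subalgebra.inclusion hS₂).comp (φ i)
  refine ⟨S₂, hf₂, t.card, fun i => bcMap f (ψ i) ⁻¹ᵁ V (e i).1, ?_, fun i =>
    Q.of_isPullback (isPullback_opens_bcMap (ψ i) (V (e i).1)) (hV _)⟩
  rw [← h₂, Scheme.Hom.preimage_iSup]
  congr 1
  ext1 i
  rw [← Scheme.Hom.comp_preimage, bcMap_comp]

end

/-! ### Spreading out smoothness -/

attribute [local instance] Algebra.TensorProduct.rightAlgebra in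
theorem isPushout_of_algEquiv {S A B C : Type*} [CommRing S] [CommRing A] [CommRing B] [CommRing C]
    [Algebra S A] [Algebra S B] [Algebra S C] [Algebra A C] [Algebra B C] [IsScalarTower S A C]
    [IsScalarTower S B C] (e : A ⊗[S] B ≃ₐ[A] C) (he : ∀ b, algebraMap B C b = e (1 ⊗ₜ b)) :
    Algebra.IsPushout S A B C :=
  Algebra.IsPushout.of_equiv e (RingHom.ext fun b => (he b).symm)

theorem isPullback_specMap (R S A B : Type u) [CommRing R] [CommRing S] [CommRing A] [CommRing B]
    [Algebra R S] [Algebra R A] [Algebra S B] [Algebra A B] [Algebra R B] [IsScalarTower R S B]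
    [IsScalarTower R A B] [Algebra.IsPushout R S A B] :
    IsPullback (specMap A B) (specMap S B) (specMap R A) (specMap R S) :=
  (isPullback_SpecMap_of_isPushout _ _ _ _ (CommRingCat.isPushout_of_isPushout R S A B)).flip

theorem exists_spread_of_chart {R k : Type u} [CommRing R] [CommRing k] [Algebra R k]
    {X : Scheme.{u}} (f : X ⟶ Spec (CommRingCat.of R)) [QuasiCompact f] [QuasiSeparated f]
    [LocallyOfFinitePresentation f] (Q : MorphismProperty Scheme.{u}) [Q.IsStableUnderBaseChange]
    {B : Type u} [CommRing B] [Algebra k B] (j : Spec (CommRingCat.of B) ⟶ bc f k)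
    [IsOpenImmersion j] (hj : j ≫ bcTo f k = specMap k B) {S : Subalgebra R k} (hS : S.FG)
    (B₀ : Type u) [CommRing B₀] [Algebra S B₀] [Algebra.FinitePresentation S B₀]
    [Algebra B₀ B] [IsScalarTower S B₀ B] [Algebra.IsPushout S k B₀ B]
    (hQ : Q (specMap S B₀)) :
    ∃ S' : Subalgebra R k, S'.FG ∧ ∃ V : (bc f S').Opens, bcMap f S'.val ⁻¹ᵁ V = j.opensRange ∧
      Q (V.ι ≫ bcTo f S') := by
  have : LocallyOfFinitePresentation (specMap S B₀) := by
    rw [HasRingHomProperty.Spec_iff (P := @LocallyOfFinitePresentation)]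
    exact (RingHom.finitePresentation_algebraMap).mpr ‹_›
  refine exists_spread_of_isPullback Q j.opensRange (isCompact_range j.continuous) hS hQ
    (q := j.isoOpensRange.inv ≫ specMap B₀ B) ?_
  refine (isPullback_specMap S k B₀ B).of_iso j.isoOpensRange (Iso.refl _) (Iso.refl _)
    (Iso.refl _) (by simp) ?_ (by simp) (by simp)
  rw [← Category.assoc, Scheme.Hom.isoOpensRange_hom_ι, hj, Iso.refl_hom, Category.comp_id]

/-- A smooth scheme over a field is covered by spectra of standard smooth algebras. -/
theorem exists_standardSmooth_chart {k : Type u} [Field k] {n : ℕ} {Z : Scheme.{u}}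
    (t : Z ⟶ Spec (CommRingCat.of k)) [ht : SmoothOfRelativeDimension n t] (x : Z) :
    ∃ (B : Type u) (_ : CommRing B) (_ : Algebra k B)
      (_ : Algebra.IsStandardSmoothOfRelativeDimension n k B)
      (j : Spec (CommRingCat.of B) ⟶ Z), IsOpenImmersion j ∧ j ≫ t = specMap k B ∧
        x ∈ Set.range j := by
  obtain ⟨U, hU, V, hV, hx, e, h⟩ := ht.exists_isStandardSmoothOfRelativeDimension x
  -- The spectrum of a field is a point, so the affine open of the base is everything.
  obtain rfl : U = ⊤ := by
    refine eq_top_iff.mpr fun y _ => ?_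
    have : Subsingleton (Spec (CommRingCat.of k)) :=
      inferInstanceAs (Subsingleton (PrimeSpectrum k))
    rw [Subsingleton.elim y (t x)]
    exact e hx
  let φ : CommRingCat.of k ⟶ Γ(Z, V) := (Scheme.ΓSpecIso (CommRingCat.of k)).inv ≫ t.appLE ⊤ V e
  let := φ.hom.toAlgebra
  refine ⟨Γ(Z, V), inferInstance, inferInstance, ?_, hV.fromSpec, inferInstance, ?_, ?_⟩
  · have := (RingHom.isStandardSmoothOfRelativeDimension_respectsIso (n := n)).2 (t.appLE ⊤ V e).hom
      (Scheme.ΓSpecIso (CommRingCat.of k)).symm.commRingCatIsoToRingEquiv h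
    exact this
  · rw [← IsAffineOpen.SpecMap_appLE_fromSpec t hU hV e, IsAffineOpen.fromSpec_top]
    rw [Scheme.isoSpec_Spec]
    exact (Spec.map_comp _ _).symm
  · rw [IsAffineOpen.range_fromSpec]
    exact hx

instance (n : ℕ) :
    MorphismProperty.IsStableUnderBaseChange (@SmoothOfRelativeDimension.{u} n) :=
  smoothOfRelativeDimension_isStableUnderBaseChange n

/-- A standard smooth algebra descends to a finitely generated subalgebra, where it gives a smooth
model of a chart. Finitely many charts suffice, and smoothness is local on the source and stable
under base change. -/
theorem eventually_smoothOfRelativeDimension {R k : Type u} [CommRing R] [Field k] [Algebra R k]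
    {X : Scheme.{u}} (f : X ⟶ Spec (CommRingCat.of R)) [QuasiCompact f] [QuasiSeparated f]
    [LocallyOfFinitePresentation f] (n : ℕ) [SmoothOfRelativeDimension n (bcTo f k)] :
    Eventually R k (fun T _ _ => SmoothOfRelativeDimension n (bcTo f T)) := by
  obtain ⟨S, hS, m, V, hV, hQ⟩ := exists_spread_cover (f := f) (k := k)
      (@SmoothOfRelativeDimension n) fun x => by
    obtain ⟨B, _, _, _, j, _, hj, hx⟩ := exists_standardSmooth_chart (n := n) (bcTo f k) x
    obtain ⟨S, B₀, _, _, hS, _, ⟨e⟩⟩ :=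
      Algebra.IsStandardSmoothOfRelativeDimension.exists_subalgebra_fg (A := k) (B := B) R n
    let : Algebra B₀ B := (e.symm.toRingHom.comp
      (Algebra.TensorProduct.includeRight (R := S) (A := k) (B := B₀)).toRingHom).toAlgebra
    have : IsScalarTower S B₀ B := IsScalarTower.of_algebraMap_eq fun s => by
      change _ = e.symm (Algebra.TensorProduct.includeRight (algebraMap S B₀ s))
      rw [AlgHom.commutes]
      exact (e.symm.commutes (algebraMap S k s)).symm
    have : Algebra.IsPushout S k B₀ B := isPushout_of_algEquiv e.symm fun _ => rfl
    have : Algebra.IsStandardSmooth S B₀ :=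
      Algebra.IsStandardSmoothOfRelativeDimension.isStandardSmooth n
    obtain ⟨S', hS', V, hV, hQ⟩ := exists_spread_of_chart f (@SmoothOfRelativeDimension n) j hj hS B₀
      (by
        rw [HasRingHomProperty.Spec_iff (P := @SmoothOfRelativeDimension n)]
        exact RingHom.locally_of RingHom.isStandardSmoothOfRelativeDimension_respectsIso _
          ((RingHom.isStandardSmoothOfRelativeDimension_algebraMap n).mpr ‹_›))
    refine ⟨S', hS', V, ?_, hQ⟩
    rwa [hV]
  refine ⟨S, hS, fun T _ _ φ => ?_⟩
  have : IsZariskiLocalAtSource (@SmoothOfRelativeDimension.{u} n) :=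
    HasRingHomProperty.instIsZariskiLocalAtSource (P := @SmoothOfRelativeDimension.{u} n)
  have : SmoothOfRelativeDimension n (bcTo f S) :=
    (IsZariskiLocalAtSource.iff_of_openCover (P := @SmoothOfRelativeDimension n)
      (Scheme.openCoverOfIsOpenCover _ V hV)).mpr hQ
  exact MorphismProperty.of_isPullback (P := @SmoothOfRelativeDimension n)
    (isPullback_bcMap f φ) this

/-! ### Spreading out closed immersions -/

/-- Only finitely many algebra generators of `C` need preimages, and each preimage together with the
equation it satisfies is defined at a finite stage. -/
theorem eventually_map_surjective {R k : Type u} [CommRing R] [CommRing k] [Algebra R k]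
    {B C : Type u} [CommRing B] [CommRing C] [Algebra R B] [Algebra R C] [Algebra.FiniteType R C]
    (φ : B →ₐ[R] C)
    (h : Function.Surjective (Algebra.TensorProduct.map (AlgHom.id R k) φ)) :
    Eventually R k (fun T _ _ => Function.Surjective
      (Algebra.TensorProduct.map (AlgHom.id R T) φ)) := by
  obtain ⟨s, hs⟩ := (inferInstance : Algebra.FiniteType R C).out
  have H (c : s) : Eventually R k (fun T _ _ =>
      1 ⊗ₜ c.1 ∈ (Algebra.TensorProduct.map (AlgHom.id R T) φ).range) := by
    obtain ⟨b, hb⟩ := h (1 ⊗ₜ c.1)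
    obtain ⟨S, hS, b, rfl⟩ := TensorProduct.Algebra.exists_of_fg b
    have e {S T : Type u} [CommRing S] [CommRing T] [Algebra R S] [Algebra R T] (ψ : S →ₐ[R] T)
        (b : S ⊗[R] B) : Algebra.TensorProduct.map (AlgHom.id R T) φ
          (Algebra.TensorProduct.map ψ (AlgHom.id R B) b) = Algebra.TensorProduct.map ψ
          (AlgHom.id R C) (Algebra.TensorProduct.map (AlgHom.id R S) φ b) := by
      rw [← AlgHom.comp_apply, ← AlgHom.comp_apply, ← Algebra.TensorProduct.map_comp,
        ← Algebra.TensorProduct.map_comp]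
      rfl
    obtain ⟨S', hSS', hS', h'⟩ := TensorProduct.Algebra.eq_of_fg_of_subtype_eq hS
      (t := Algebra.TensorProduct.map (AlgHom.id R S) φ b) (t' := 1 ⊗ₜ c.1)
      ((e S.val b).symm.trans (hb.trans (by simp)))
    refine ⟨S', hS', fun T _ _ ψ => ⟨Algebra.TensorProduct.map ψ (AlgHom.id R B)
      (Algebra.TensorProduct.map (Subalgebra.inclusion hSS') (AlgHom.id R B) b), ?_⟩⟩
    change Algebra.TensorProduct.map (AlgHom.id R T) φ _ = _
    rw [e, e]
    refine (congrArg _ h').trans ?_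
    simp
  refine (Eventually.forall_finite H).mono fun T _ _ hT => ?_
  have key : ∀ c : C, (1 : T) ⊗ₜ[R] c ∈
      (Algebra.TensorProduct.map (AlgHom.id R T) φ).range := by
    intro c
    have : (Algebra.adjoin R (s : Set C)) ≤
        ((Algebra.TensorProduct.map (AlgHom.id R T) φ).range).comap
        (Algebra.TensorProduct.includeRight (R := R) (A := T) (B := C)) :=
      Algebra.adjoin_le fun c hc => hT ⟨c, hc⟩
    exact this (by rw [hs]; trivial)
  intro y
  suffices y ∈ (Algebra.TensorProduct.map (AlgHom.id R T) φ).range from this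
  induction y with
  | zero => exact zero_mem _
  | add x y hx hy => exact add_mem hx hy
  | tmul t c =>
    have : t ⊗ₜ[R] c = t ⊗ₜ 1 * 1 ⊗ₜ c := by simp
    rw [this]
    exact mul_mem ⟨t ⊗ₜ 1, by simp⟩ (key c)

/-- The base change of a morphism of schemes over `R`. -/
abbrev bcHom {R : Type u} [CommRing R] {X P : Scheme.{u}} (g : X ⟶ P)
    (h : P ⟶ Spec (CommRingCat.of R)) (T : Type u) [CommRing T] [Algebra R T] :
    pullback g (bcFst h T) ⟶ bc h T :=
  pullback.snd g (bcFst h T)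

/-- The base change of a morphism of schemes over `R`, in terms of arbitrary pullback squares. -/
theorem prop_bcHom_iff (W : MorphismProperty Scheme.{u}) [W.RespectsIso] {R : Type u} [CommRing R]
    {X P X' P' : Scheme.{u}} {g : X ⟶ P} {h : P ⟶ Spec (CommRingCat.of R)} {T : Type u}
    [CommRing T] [Algebra R T] {a : P' ⟶ P} {b : P' ⟶ Spec (CommRingCat.of T)}
    (hP : IsPullback a b h (specMap R T)) {x : X' ⟶ X} {g' : X' ⟶ P'} (hX : IsPullback x g' g a) :
    W (bcHom g h T) ↔ W g' := by
  have e : hP.isoPullback.hom ≫ bcFst h T = a := hP.isoPullback_hom_fst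
  have h₁ : IsPullback x (g' ≫ hP.isoPullback.hom) g (bcFst h T) := by
    refine hX.of_iso (Iso.refl _) (Iso.refl _) hP.isoPullback (Iso.refl _) (by simp) (by simp)
      (by simp) (by simp [e])
  have h₂ := h₁.isoPullback_hom_snd
  rw [← W.cancel_left_of_respectsIso h₁.isoPullback.hom (bcHom g h T), h₂,
    W.cancel_right_of_respectsIso]

/-- The global sections of a scheme over a ring, as an algebra. -/
abbrev sectionsAlgebra {R : Type u} [CommRing R] {P : Scheme.{u}}
    (h : P ⟶ Spec (CommRingCat.of R)) : Algebra R Γ(P, ⊤) :=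
  ((Scheme.ΓSpecIso _).inv ≫ h.appTop).hom.toAlgebra

theorem toSpecΓ_specMap {R : Type u} [CommRing R] {P : Scheme.{u}}
    (h : P ⟶ Spec (CommRingCat.of R)) :
    letI := sectionsAlgebra h
    P.toSpecΓ ≫ specMap R Γ(P, ⊤) = h := by
  refine (congrArg (P.toSpecΓ ≫ ·) (Spec.map_comp (Scheme.ΓSpecIso (.of R)).inv h.appTop)).trans ?_
  rw [← Scheme.toSpecΓ_naturality_assoc, ← Scheme.isoSpec_Spec_inv, ← Scheme.isoSpec_hom]
  simp

theorem isPullback_tensorProduct {R T : Type u} [CommRing R] [CommRing T] [Algebra R T]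
    {P : Scheme.{u}} [IsAffine P] (h : P ⟶ Spec (CommRingCat.of R)) :
    letI := sectionsAlgebra h
    IsPullback (Spec.map (CommRingCat.ofHom
      (Algebra.TensorProduct.includeRight (R := R) (A := T) (B := Γ(P, ⊤))).toRingHom) ≫
      P.isoSpec.inv) (specMap T (T ⊗[R] Γ(P, ⊤))) h (specMap R T) := by
  let := sectionsAlgebra h
  refine (isPullback_SpecMap_of_isPushout _ _ _ _
    (CommRingCat.isPushout_tensorProduct R T Γ(P, ⊤))).flip.of_iso (Iso.refl _)
    P.isoSpec.symm (Iso.refl _) (Iso.refl _) (by simp) (by simp) ?_ (by simp)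
  rw [Iso.refl_hom, Category.comp_id, Iso.symm_hom, Iso.eq_inv_comp]
  exact toSpecΓ_specMap h

/-- Between affine schemes a closed immersion is a surjection of rings, and base change is the
tensor product. -/
theorem eventually_isClosedImmersion_of_isAffine {R k : Type u} [CommRing R] [CommRing k]
    [Algebra R k] {X P : Scheme.{u}} (g : X ⟶ P) (h : P ⟶ Spec (CommRingCat.of R)) [IsAffine X]
    [IsAffine P] [LocallyOfFiniteType (g ≫ h)] [IsClosedImmersion (bcHom g h k)] :
    Eventually R k (fun T _ _ => IsClosedImmersion (bcHom g h T)) := by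
  let := sectionsAlgebra h
  let := sectionsAlgebra (g ≫ h)
  let φ : Γ(P, ⊤) →ₐ[R] Γ(X, ⊤) := { g.appTop.hom with commutes' := fun r => rfl }
  have : Algebra.FiniteType R Γ(X, ⊤) := by
    have h₁ : (g ≫ h).appTop.hom.FiniteType :=
      (HasRingHomProperty.iff_of_isAffine (P := @LocallyOfFiniteType)).mp ‹_›
    have h₂ := RingHom.finiteType_respectsIso.2 _
      (Scheme.ΓSpecIso (CommRingCat.of R)).symm.commRingCatIsoToRingEquiv h₁
    exact h₂
  have key (T : Type u) [CommRing T] [Algebra R T] : IsClosedImmersion (bcHom g h T) ↔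
      Function.Surjective (Algebra.TensorProduct.map (AlgHom.id R T) φ) := by
    rw [prop_bcHom_iff @IsClosedImmersion (isPullback_tensorProduct (T := T) h)
      (x := (Spec.map (CommRingCat.ofHom
        (Algebra.TensorProduct.includeRight (R := R) (A := T) (B := Γ(X, ⊤))).toRingHom) ≫
        X.isoSpec.inv)) (g' := Spec.map (CommRingCat.ofHom
          (Algebra.TensorProduct.map (AlgHom.id R T) φ).toRingHom))]
    · refine ⟨fun H => ?_, fun H => IsClosedImmersion.spec_of_surjective _ H⟩
      have h₁ := (IsClosedImmersion.isAffine_surjective_of_isAffine (Spec.map (CommRingCat.ofHom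
          (Algebra.TensorProduct.map (AlgHom.id R T) φ).toRingHom))).2
      have h₂ := Scheme.ΓSpecIso_naturality (CommRingCat.ofHom
        (Algebra.TensorProduct.map (AlgHom.id R T) φ).toRingHom)
      rw [← Iso.inv_comp_eq] at h₂
      have h₃ : Function.Surjective (CommRingCat.ofHom
        (Algebra.TensorProduct.map (AlgHom.id R T) φ).toRingHom).hom := by
        rw [← h₂]
        exact ((Scheme.ΓSpecIso _).commRingCatIsoToRingEquiv.surjective.comp h₁).comp
          (Scheme.ΓSpecIso _).symm.commRingCatIsoToRingEquiv.surjective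
      exact h₃
    · refine IsPullback.of_bot (v₂₁ := specMap T (T ⊗[R] Γ(P, ⊤))) (h₃₁ := specMap R T) ?_ ?_
        (isPullback_tensorProduct h)
      · convert isPullback_tensorProduct (T := T) (g ≫ h) using 1
        rw [← Spec.map_comp, ← CommRingCat.ofHom_comp]
        congr 2
        ext t
        exact (Algebra.TensorProduct.map_tmul _ _ _ _).trans (congrArg (t ⊗ₜ ·) (map_one φ))
      · rw [Category.assoc, ← Scheme.isoSpec_inv_naturality, ← Spec.map_comp_assoc,
          ← Spec.map_comp_assoc, ← CommRingCat.ofHom_comp]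
        congr 2
  have hk := (key k).mp ‹_›
  exact (eventually_map_surjective φ hk).mono fun T _ _ hT => (key T).mpr hT

/-- Closed immersions into affine schemes spread out. -/
theorem eventually_isClosedImmersion_of_isAffine_right {R k : Type u} [CommRing R] [CommRing k]
    [Algebra R k] {X P : Scheme.{u}} (g : X ⟶ P) (h : P ⟶ Spec (CommRingCat.of R))
    [IsAffine P] [QuasiCompact (g ≫ h)] [QuasiSeparated (g ≫ h)] [LocallyOfFiniteType (g ≫ h)]
    [IsClosedImmersion (bcHom g h k)] :
    Eventually R k (fun T _ _ => IsClosedImmersion (bcHom g h T)) := by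
  have hX (T : Type u) [CommRing T] [Algebra R T] : IsPullback (pullback.fst g (bcFst h T))
      (pullback.snd g (bcFst h T) ≫ bcTo h T) (g ≫ h) (specMap R T) :=
    (IsPullback.of_hasPullback g (bcFst h T)).paste_vert (IsPullback.of_hasPullback h (specMap R T))
  -- Being closed in an affine scheme, the base change of `X` to `k` is affine. Affineness spreads
  -- out, which reduces to the case of two affine schemes over `S`.
  have : IsAffine (bc (g ≫ h) k) := by
    have : IsAffine (pullback g (bcFst h k)) := isAffine_of_isAffineHom (bcHom g h k)
    exact .of_isIso (hX k).isoPullback.inv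
  obtain ⟨S, hS, hA⟩ := exists_spread_isAffine (f := g ≫ h) (k := k)
  have : IsAffine (pullback g (bcFst h S)) := .of_isIso (hX S).isoPullback.hom
  have hT (T : Type u) [CommRing T] [Algebra R T] [Algebra S T] [IsScalarTower R S T] :
      IsClosedImmersion (bcHom (bcHom g h S) (bcTo h S) T) ↔ IsClosedImmersion (bcHom g h T) := by
    refine (prop_bcHom_iff @IsClosedImmersion (a := bcFst (bcTo h S) T ≫ bcFst h S)
      (b := bcTo (bcTo h S) T) ?_ (x := pullback.fst _ _ ≫ pullback.fst _ _) ?_).symm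
    · have := (IsPullback.of_hasPullback (bcTo h S) (specMap S T)).paste_horiz
        (IsPullback.of_hasPullback h (specMap R S))
      rwa [specMap_specMap] at this
    · exact (IsPullback.of_hasPullback _ _).paste_horiz (IsPullback.of_hasPullback _ _)
  have : LocallyOfFiniteType (bcHom g h S ≫ bcTo h S) :=
    MorphismProperty.of_isPullback (hX S) ‹LocallyOfFiniteType (g ≫ h)›
  have : IsClosedImmersion (bcHom (bcHom g h S) (bcTo h S) k) := (hT k).mpr ‹_›
  exact (eventually_isClosedImmersion_of_isAffine (k := k) (bcHom g h S) (bcTo h S)).of_stage hS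
    fun T _ _ _ _ h => (hT T).mp h

/-- Closed immersions spread out. -/
theorem eventually_isClosedImmersion {R k : Type u} [CommRing R] [CommRing k]
    [Algebra R k] {X P : Scheme.{u}} (g : X ⟶ P) (h : P ⟶ Spec (CommRingCat.of R))
    [CompactSpace P] [QuasiCompact g] [QuasiSeparated g] [LocallyOfFiniteType (g ≫ h)]
    [IsClosedImmersion (bcHom g h k)] :
    Eventually R k (fun T _ _ => IsClosedImmersion (bcHom g h T)) := by
  -- Being a closed immersion is local on the target, so a finite affine cover of `P` reduces to
  -- affine targets.
  let 𝒰 := P.affineCover.finiteSubcover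
  have : Finite 𝒰.I₀ := inferInstance
  have hT (T : Type u) [CommRing T] [Algebra R T] (i : 𝒰.I₀) :
      IsClosedImmersion (bcHom (pullback.snd g (𝒰.f i)) (𝒰.f i ≫ h) T) ↔ IsClosedImmersion
        (pullback.snd (bcHom g h T) (pullback.fst (bcFst h T) (𝒰.f i))) := by
    refine prop_bcHom_iff @IsClosedImmersion (a := pullback.snd (bcFst h T) (𝒰.f i))
      (b := pullback.fst (bcFst h T) (𝒰.f i) ≫ bcTo h T) ?_ (x := pullback.lift
        (pullback.fst _ _ ≫ pullback.fst _ _) (pullback.snd _ _ ≫ pullback.snd _ _) ?_) ?_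
    · exact (IsPullback.of_hasPullback (bcFst h T) (𝒰.f i)).flip.paste_vert
        (IsPullback.of_hasPullback h (specMap R T))
    · rw [Category.assoc, Category.assoc, pullback.condition, pullback.condition_assoc,
        pullback.condition]
    · refine IsPullback.of_right (h₁₂ := pullback.fst g (𝒰.f i)) (h₂₂ := 𝒰.f i) (v₁₃ := g) ?_
        (pullback.lift_snd _ _ _) (IsPullback.of_hasPullback _ _)
      rw [pullback.lift_fst, ← pullback.condition]
      exact (IsPullback.of_hasPullback _ _).paste_horiz (IsPullback.of_hasPullback _ _)
  have H (i : 𝒰.I₀) : Eventually R k (fun T _ _ =>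
      IsClosedImmersion (bcHom (pullback.snd g (𝒰.f i)) (𝒰.f i ≫ h) T)) := by
    have h₁ : LocallyOfFiniteType (pullback.snd g (𝒰.f i) ≫ 𝒰.f i ≫ h) := by
      rw [← pullback.condition_assoc]
      infer_instance
    have h₂ : IsClosedImmersion (bcHom (pullback.snd g (𝒰.f i)) (𝒰.f i ≫ h) k) :=
      (hT k i).mpr inferInstance
    have : IsAffine (𝒰.X i) := inferInstanceAs (IsAffine (P.affineCover.X _))
    have : QuasiCompact (𝒰.f i ≫ h) := inferInstance
    have : QuasiSeparated (𝒰.f i ≫ h) := inferInstance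
    exact eventually_isClosedImmersion_of_isAffine_right _ _
  refine (Eventually.forall_finite H).mono fun T _ _ h' => ?_
  refine IsZariskiLocalAtTarget.of_openCover (P := @IsClosedImmersion) (𝒰.pullback₁ (bcFst h T))
    fun i => (hT T i).mp (h' i)

/-! ### Spreading out projectivity -/

theorem finiteType_homogeneousSubmodule_zero (N : ℕ) :
    letI := MvPolynomial.gradedAlgebra (σ := Fin (N + 1)) (R := ULift.{u} ℤ)
    Algebra.FiniteType (ULift.{u} ℤ)
      (MvPolynomial.homogeneousSubmodule (Fin (N + 1)) (ULift.{u} ℤ) 0) := by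
  let := MvPolynomial.gradedAlgebra (σ := Fin (N + 1)) (R := ULift.{u} ℤ)
  refine Algebra.FiniteType.of_surjective (Algebra.ofId (ULift.{u} ℤ) _) fun x => ?_
  obtain ⟨p, hp⟩ := x
  have h := hp
  rw [MvPolynomial.mem_homogeneousSubmodule, ← MvPolynomial.totalDegree_zero_iff_isHomogeneous,
    MvPolynomial.totalDegree_eq_zero_iff_eq_C] at h
  exact ⟨p.coeff 0, Subtype.ext h.symm⟩

/-- `Proj` is separated and of finite type over its degree zero part, which consists of constants.
Finite type becomes finite presentation because the base is noetherian. -/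
theorem projectiveSpaceInt_finiteType (N : ℕ) :
    QuasiCompact (terminal.from (projectiveSpaceInt.{u} N)) ∧
      QuasiSeparated (terminal.from (projectiveSpaceInt.{u} N)) ∧
        LocallyOfFinitePresentation (terminal.from (projectiveSpaceInt.{u} N)) := by
  let := MvPolynomial.gradedAlgebra (σ := Fin (N + 1)) (R := ULift.{u} ℤ)
  let 𝒜 := MvPolynomial.homogeneousSubmodule (Fin (N + 1)) (ULift.{u} ℤ)
  have h₀ : Algebra.FiniteType (ULift.{u} ℤ) (𝒜 0) := finiteType_homogeneousSubmodule_zero N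
  have : IsScalarTower (ULift.{u} ℤ) (𝒜 0) (MvPolynomial (Fin (N + 1)) (ULift.{u} ℤ)) :=
    ⟨fun a b c => smul_mul_assoc a b.1 c⟩
  have h₁ : Algebra.FiniteType (𝒜 0) (MvPolynomial (Fin (N + 1)) (ULift.{u} ℤ)) :=
    Algebra.FiniteType.of_restrictScalars_finiteType (ULift.{u} ℤ) _ _
  have h₂ : IsIso (terminal.from (Spec (.of (ULift.{u} ℤ)))) :=
    isIso_of_isTerminal specULiftZIsTerminal terminalIsTerminal _
  have e : terminal.from (projectiveSpaceInt.{u} N) = Proj.toSpecZero 𝒜 ≫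
    specMap (ULift.{u} ℤ) (𝒜 0) ≫ terminal.from (Spec (.of (ULift.{u} ℤ))) := Subsingleton.elim _ _
  have h₃ : LocallyOfFiniteType (specMap (ULift.{u} ℤ) (𝒜 0)) := by
    rw [HasRingHomProperty.Spec_iff (P := @LocallyOfFiniteType)]
    exact RingHom.finiteType_algebraMap.mpr h₀
  have : IsNoetherianRing (ULift.{u} ℤ) := isNoetherianRing_of_ringEquiv ℤ ULift.ringEquiv.symm
  have : IsLocallyNoetherian (⊤_ Scheme.{u}) :=
    isLocallyNoetherian_of_isOpenImmersion (inv (terminal.from (Spec (.of (ULift.{u} ℤ)))))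
  have h₄ : QuasiCompact (Proj.toSpecZero 𝒜) := inferInstance
  have h₅ : LocallyOfFiniteType (Proj.toSpecZero 𝒜) := inferInstance
  have h₆ : IsSeparated (Proj.toSpecZero 𝒜) := inferInstance
  have h₇ : LocallyOfFiniteType (terminal.from (projectiveSpaceInt.{u} N)) := by
    rw [e]
    exact MorphismProperty.comp_mem _ _ _ h₅ (MorphismProperty.comp_mem _ _ _ h₃ inferInstance)
  refine ⟨?_, ?_, inferInstance⟩
  · rw [e]
    exact MorphismProperty.comp_mem _ _ _ h₄ inferInstance
  · rw [e]
    exact MorphismProperty.comp_mem _ _ _ (inferInstance : QuasiSeparated (Proj.toSpecZero 𝒜))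
      inferInstance

/-- Functoriality of projective space in the base. -/
def projectiveSpaceMap {S T : Scheme.{u}} (N : ℕ) (g : T ⟶ S) :
    projectiveSpace N T ⟶ projectiveSpace N S :=
  pullback.lift (projectiveSpaceTo N T ≫ g) (pullback.snd _ _) (Subsingleton.elim _ _)

theorem projectiveSpaceMap_fst {S T : Scheme.{u}} (N : ℕ) (g : T ⟶ S) :
    projectiveSpaceMap N g ≫ projectiveSpaceTo N S = projectiveSpaceTo N T ≫ g :=
  pullback.lift_fst _ _ _

theorem projectiveSpaceMap_snd {S T : Scheme.{u}} (N : ℕ) (g : T ⟶ S) :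
    projectiveSpaceMap N g ≫ pullback.snd _ _ = pullback.snd _ _ :=
  pullback.lift_snd _ _ _

theorem isPullback_projectiveSpace {S T : Scheme.{u}} (N : ℕ) (g : T ⟶ S) :
    IsPullback (projectiveSpaceMap N g) (projectiveSpaceTo N T) (projectiveSpaceTo N S) g := by
  refine IsPullback.of_right (h₁₂ := pullback.snd _ _) (h₂₂ := terminal.from S)
    (v₁₃ := terminal.from (projectiveSpaceInt N)) ?_ (projectiveSpaceMap_fst N g)
    (IsPullback.of_hasPullback _ _).flip
  have e : (projectiveSpaceMap N g ≫ pullback.snd (terminal.from S)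
      (terminal.from (projectiveSpaceInt N)) : projectiveSpace N T ⟶ _) = pullback.snd _ _ :=
    projectiveSpaceMap_snd N g
  erw [e]
  rw [Subsingleton.elim (g ≫ terminal.from S) (terminal.from T)]
  exact (IsPullback.of_hasPullback (terminal.from T) (terminal.from (projectiveSpaceInt N))).flip

/-- Only the component of the embedding into projective space over the integers has to be spread
out. The resulting morphism to projective space over `S` is a closed immersion after base change to
`k`, hence eventually. -/
theorem eventually_isProjective {R k : Type u} [CommRing R] [CommRing k] [Algebra R k]
    {X : Scheme.{u}} (f : X ⟶ Spec (CommRingCat.of R)) [QuasiCompact f] [QuasiSeparated f]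
    [LocallyOfFiniteType f] (h : IsProjective (bcTo f k)) :
    Eventually R k (fun T _ _ => IsProjective (bcTo f T)) := by
  obtain ⟨N, i, hi, hi'⟩ := h
  obtain ⟨h₁, h₂, h₃⟩ := projectiveSpaceInt_finiteType.{u} N
  obtain ⟨S, hS, g, -, hg⟩ := exists_spread_hom (f := f) (terminal.from (projectiveSpaceInt.{u} N))
    (terminal.from X) (i ≫ pullback.snd _ _) (Subsingleton.elim _ _)
  let P := projectiveSpace N (Spec (CommRingCat.of S))
  let p : P ⟶ Spec (CommRingCat.of S) := projectiveSpaceTo N _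
  let g' : bc f S ⟶ P := pullback.lift (bcTo f S) g (Subsingleton.elim _ _)
  have hg' : g' ≫ p = bcTo f S := pullback.lift_fst _ _ _
  have : QuasiCompact p := inferInstanceAs (QuasiCompact (pullback.fst _ _))
  have : QuasiSeparated p := inferInstanceAs (QuasiSeparated (pullback.fst _ _))
  have : QuasiCompact (g' ≫ p) := by rw [hg']; infer_instance
  have : QuasiSeparated (g' ≫ p) := by rw [hg']; infer_instance
  have : LocallyOfFiniteType (g' ≫ p) := by rw [hg']; infer_instance
  have : QuasiCompact g' := .of_comp g' p
  have : QuasiSeparated g' := .of_comp g' p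
  have : CompactSpace P := QuasiCompact.compactSpace_of_compactSpace p
  have hX {T : Type u} [CommRing T] [Algebra R T] (φ : S →ₐ[R] T) (j : bc f T ⟶ projectiveSpace N _)
      (hj : j ≫ projectiveSpaceTo N _ = bcTo f T)
      (hj' : j ≫ pullback.snd _ _ = bcMap f φ ≫ g) :
      IsPullback (bcMap f φ) j g' (projectiveSpaceMap N (specMapHom φ)) := by
    refine IsPullback.of_bot ?_ ?_ (isPullback_projectiveSpace N (specMapHom φ))
    · rw [hj]
      convert isPullback_bcMap f φ
    · apply pullback.hom_ext
      · refine (Category.assoc _ _ _).trans ((congrArg (bcMap f φ ≫ ·) hg').trans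
          ((bcMap_snd f φ).trans ?_))
        rw [← hj]
        refine (Category.assoc _ _ _).trans (Eq.trans ?_ (Category.assoc _ _ _).symm)
        exact congrArg (j ≫ ·) (projectiveSpaceMap_fst N (specMapHom φ)).symm
      · refine (Category.assoc _ _ _).trans ((congrArg (bcMap f φ ≫ ·)
          (pullback.lift_snd _ _ _)).trans (hj'.symm.trans ?_))
        refine Eq.trans ?_ (Category.assoc _ _ _).symm
        exact congrArg (j ≫ ·) (projectiveSpaceMap_snd N (specMapHom φ)).symm
  have : IsClosedImmersion (bcHom g' p k) := 
    (prop_bcHom_iff @IsClosedImmersion (isPullback_projectiveSpace N (specMap S k))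
      (hX S.val i hi' hg.symm)).mpr hi
  refine Eventually.of_stage hS (eventually_isClosedImmersion (k := k) g' p) fun T _ _ _ _ hT => ?_
  let φ : S →ₐ[R] T := IsScalarTower.toAlgHom R S T
  let j : bc f T ⟶ projectiveSpace N _ := pullback.lift (bcTo f T) (bcMap f φ ≫ g)
    (Subsingleton.elim _ _)
  have hj : j ≫ projectiveSpaceTo N _ = bcTo f T := pullback.lift_fst _ _ _
  exact ⟨N, j, (prop_bcHom_iff @IsClosedImmersion (isPullback_projectiveSpace N (specMap S T))
      (hX φ j hj (pullback.lift_snd _ _ _))).mp hT, hj⟩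

/-! ### Spreading out non-emptiness -/

/-- A nonempty scheme locally of finite type over an algebraically closed field has a rational
point. The point spreads out to a stage and then gives a section over every `T`. -/
theorem eventually_nonempty {R k : Type u} [CommRing R] [Field k] [IsAlgClosed k] [Algebra R k]
    {X : Scheme.{u}} (f : X ⟶ Spec (CommRingCat.of R)) [LocallyOfFinitePresentation f]
    [Nonempty (bc f k)] :
    Eventually R k (fun T _ _ => Nontrivial T → Nonempty (bc f T)) := by
  have : JacobsonSpace (bc f k) := LocallyOfFiniteType.jacobsonSpace (bcTo f k)
  obtain ⟨x, -, hx⟩ := nonempty_inter_closedPoints (X := bc f k) Set.univ_nonempty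
    isClosed_univ.isLocallyClosed
  let t := pointOfClosedPoint (bcTo f k) x hx
  have ht : t ≫ bcTo f k = 𝟙 _ := pointOfClosedPoint_comp _ _ _
  -- Base changes of the identity of `Spec R` are spectra of the algebras, so a point is spread out
  -- as a morphism from such a base change.
  obtain ⟨S, hS, g, hg, -⟩ := exists_spread_hom (f := 𝟙 (Spec (CommRingCat.of R))) (k := k) f (𝟙 _)
    (bcTo _ k ≫ t ≫ bcFst f k) (by
      rw [Category.assoc, Category.assoc, pullback.condition, reassoc_of% ht, pullback.condition])
  refine ⟨S, hS, fun T _ _ φ _ => ?_⟩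
  let s : Spec (CommRingCat.of T) ⟶ bc (𝟙 (Spec (CommRingCat.of R))) T :=
    pullback.lift (specMap R T) (𝟙 _) (by simp)
  let b : Spec (CommRingCat.of T) ⟶ bc f T := pullback.lift
    (s ≫ bcMap _ φ ≫ g) (𝟙 _) (by
      simp only [Category.assoc, hg, Category.id_comp, Category.comp_id]
      exact ((congrArg (s ≫ ·) (bcMap_fst _ φ)).trans (pullback.lift_fst _ _ _)))
  exact Nonempty.map b inferInstance

/-! ### Spreading out the absence of solutions of polynomial equations -/

/-- By the Nullstellensatz the absence of `k`-points means `k ⊗ D = 0`. The equation `1 = 0` holds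
already over some stage `S`, and any point over a nontrivial `S`-algebra would transport it there.
-/
theorem eventually_isEmpty_algHom {R k : Type u} [CommRing R] [Field k] [IsAlgClosed k]
    [Algebra R k] (D : Type u) [CommRing D] [Algebra R D] [Algebra.FiniteType R D]
    (h : IsEmpty (D →ₐ[R] k)) :
    Eventually R k (fun T _ _ => Nontrivial T → IsEmpty (D →ₐ[R] T)) := by
  have h₀ : Subsingleton (k ⊗[R] D) := by
    by_contra hn
    rw [not_subsingleton_iff_nontrivial] at hn
    obtain ⟨m, hm⟩ := Ideal.exists_maximal (k ⊗[R] D)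
    let := Ideal.Quotient.field m
    have : Algebra.FiniteType k ((k ⊗[R] D) ⧸ m) :=
      Algebra.FiniteType.of_surjective (Ideal.Quotient.mkₐ k m) Ideal.Quotient.mk_surjective
    have : Module.Finite k ((k ⊗[R] D) ⧸ m) := finite_of_finite_type_of_isJacobsonRing _ _
    let l : ((k ⊗[R] D) ⧸ m) →ₐ[k] k := IsAlgClosed.lift
    exact h.false (((l.comp (Ideal.Quotient.mkₐ k m)).restrictScalars R).comp
      Algebra.TensorProduct.includeRight)
  obtain ⟨S, hle, hS, hS'⟩ := TensorProduct.Algebra.eq_of_fg_of_subtype_eq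
    (Subalgebra.fg_bot (R := R) (A := k)) (N := D) (t := 1 ⊗ₜ 1) (t' := 0) (Subsingleton.elim _ _)
  refine ⟨S, hS, fun T _ _ φ _ => ⟨fun ψ => ?_⟩⟩
  have := congrArg (Algebra.TensorProduct.lift φ ψ (fun _ _ => Commute.all _ _)) hS'
  simp at this

theorem eventually_no_solution {R k : Type u} [CommRing R] [Field k] [IsAlgClosed k]
    [Algebra R k] {τ : Type} [Finite τ] (E : Set (MvPolynomial τ R))
    (h : ¬ ∃ a : τ → k, ∀ e ∈ E, MvPolynomial.aeval a e = 0) :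
    Eventually R k (fun T _ _ => Nontrivial T →
      ¬ ∃ a : τ → T, ∀ e ∈ E, MvPolynomial.aeval a e = 0) := by
  refine (eventually_isEmpty_algHom (MvPolynomial τ R ⧸ Ideal.span E) ⟨fun ψ => ?_⟩).mono
    fun T _ _ hT hn => ?_
  · refine h ⟨fun i => ψ (Ideal.Quotient.mk _ (MvPolynomial.X i)), fun e he => ?_⟩
    have : MvPolynomial.aeval (fun i => ψ (Ideal.Quotient.mk _ (MvPolynomial.X i))) =
        ψ.comp (Ideal.Quotient.mkₐ R (Ideal.span E)) := by
      ext; simp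
    rw [this, AlgHom.comp_apply, Ideal.Quotient.mkₐ_eq_mk,
      Ideal.Quotient.eq_zero_iff_mem.mpr (Ideal.subset_span he), map_zero]
  · rintro ⟨a, ha⟩
    refine (hT hn).false (Ideal.Quotient.liftₐ _ (MvPolynomial.aeval a) ?_)
    exact fun x hx => (Ideal.span_le (I := RingHom.ker (MvPolynomial.aeval a))).mpr ha hx

theorem eventually_ne_zero {R k : Type u} [CommRing R] [Field k] [IsAlgClosed k]
    [Algebra R k] (c : R) (hc : algebraMap R k c ≠ 0) :
    Eventually R k (fun T _ _ => Nontrivial T → algebraMap R T c ≠ 0) := by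
  -- In no variables, the equation `c = 0` is solvable over an algebra exactly when `c` vanishes
  -- there.
  refine (eventually_no_solution (τ := Empty) {MvPolynomial.C c} ?_).mono fun T _ _ hT hn h => ?_
  · simpa using hc
  · exact hT hn ⟨Empty.elim, by simpa using h⟩

/-! ### Spreading out irreducibility of polynomials -/

section

variable {R : Type u} [CommRing R] {σ : Type}

/-- The polynomial with given coefficients at a finite set of monomials. -/
def polynomialOfCoeffs {A : Type*} [CommRing A] (s : Finset (σ →₀ ℕ)) (b : s → A) :
    MvPolynomial σ A :=
  ∑ i, MvPolynomial.monomial i.1 (b i)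

theorem map_polynomialOfCoeffs {A B : Type*} [CommRing A] [CommRing B] (f : A →+* B)
    (s : Finset (σ →₀ ℕ)) (b : s → A) :
    MvPolynomial.map f (polynomialOfCoeffs s b) = polynomialOfCoeffs s (fun i => f (b i)) := by
  simp [polynomialOfCoeffs]

theorem polynomialOfCoeffs_coeff {A : Type*} [CommRing A] (s : Finset (σ →₀ ℕ))
    (g : MvPolynomial σ A) (hg : g.support ⊆ s) :
    polynomialOfCoeffs s (fun i => g.coeff i.1) = g := by
  conv_rhs => rw [← g.support_sum_monomial_coeff]
  rw [polynomialOfCoeffs, Finset.sum_coe_sort s (fun i => MvPolynomial.monomial i (g.coeff i))]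
  refine (Finset.sum_subset hg fun i _ hi => ?_).symm
  rw [MvPolynomial.notMem_support_iff.mp hi, MvPolynomial.monomial_zero]

theorem coeff_polynomialOfCoeffs {A : Type*} [CommRing A] (s : Finset (σ →₀ ℕ)) (b : s → A)
    (i : s) : (polynomialOfCoeffs s b).coeff i.1 = b i := by
  classical
  rw [polynomialOfCoeffs, MvPolynomial.coeff_sum, Finset.sum_eq_single i]
  · simp
  · intro j _ hj
    rw [MvPolynomial.coeff_monomial, if_neg fun h => hj (Subtype.ext h)]
  · simp

/-- A system of polynomial equations for the coefficients of nontrivial factorizations of a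
polynomial. -/
def factorizationEquations (p : MvPolynomial σ R) (s : Finset (σ →₀ ℕ)) (m m' : s) :
    Set (MvPolynomial (s ⊕ s ⊕ Bool) R) :=
  Set.range (fun d => (polynomialOfCoeffs s (fun i => MvPolynomial.X (Sum.inl i)) *
    polynomialOfCoeffs s (fun i => MvPolynomial.X (Sum.inr (Sum.inl i))) -
      MvPolynomial.map MvPolynomial.C p).coeff d) ∪
  -- The two variables indexed by `Bool` are inverses of the coefficients at `m` and `m'`, which
  -- forces these to be nonzero.
  {MvPolynomial.X (Sum.inl m) * MvPolynomial.X (Sum.inr (Sum.inr true)) - 1,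
    MvPolynomial.X (Sum.inr (Sum.inl m')) * MvPolynomial.X (Sum.inr (Sum.inr false)) - 1}

theorem exists_factorizationEquations_iff {T : Type u} [Field T] [Algebra R T]
    (p : MvPolynomial σ R) (s : Finset (σ →₀ ℕ)) (m m' : s) :
    (∃ a : s ⊕ s ⊕ Bool → T, ∀ e ∈ factorizationEquations p s m m', MvPolynomial.aeval a e = 0) ↔
    ∃ g h : MvPolynomial σ T, g.support ⊆ s ∧ h.support ⊆ s ∧ g.coeff m ≠ 0 ∧ h.coeff m' ≠ 0 ∧
      g * h = MvPolynomial.map (algebraMap R T) p := by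
  have key (a : s ⊕ s ⊕ Bool → T) (d : σ →₀ ℕ) : MvPolynomial.aeval a
      ((polynomialOfCoeffs s (fun i => (MvPolynomial.X (Sum.inl i) :
          MvPolynomial (s ⊕ s ⊕ Bool) R)) *
        polynomialOfCoeffs s (fun i => MvPolynomial.X (Sum.inr (Sum.inl i))) -
        MvPolynomial.map MvPolynomial.C p).coeff d) =
      (polynomialOfCoeffs s (fun i => a (Sum.inl i)) *
        polynomialOfCoeffs s (fun i => a (Sum.inr (Sum.inl i))) -
        MvPolynomial.map (algebraMap R T) p).coeff d := by
    refine (MvPolynomial.coeff_map (MvPolynomial.aeval a : _ →ₐ[R] T).toRingHom _ d).symm.trans ?_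
    rw [map_sub, map_mul, map_polynomialOfCoeffs, map_polynomialOfCoeffs, MvPolynomial.map_map]
    have h₁ (i) : (MvPolynomial.aeval a : _ →ₐ[R] T).toRingHom (MvPolynomial.X i) = a i :=
      MvPolynomial.aeval_X a i
    have h₂ : (MvPolynomial.aeval a : _ →ₐ[R] T).toRingHom.comp MvPolynomial.C = algebraMap R T :=
      RingHom.ext fun r => MvPolynomial.aeval_C a r
    simp only [h₁, h₂]
  have hs (b : s → T) : (polynomialOfCoeffs s b).support ⊆ s := by
    intro d hd
    by_contra hds
    refine MvPolynomial.mem_support_iff.mp hd ?_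
    classical
    rw [polynomialOfCoeffs, MvPolynomial.coeff_sum]
    refine Finset.sum_eq_zero fun i _ => ?_
    rw [MvPolynomial.coeff_monomial, if_neg]
    rintro rfl
    exact hds i.2
  constructor
  · rintro ⟨a, ha⟩
    have h₁ := ha _ (.inr (.inl rfl))
    have h₂ := ha _ (.inr (.inr rfl))
    refine ⟨polynomialOfCoeffs s (fun i => a (.inl i)),
      polynomialOfCoeffs s (fun i => a (.inr (.inl i))), hs _, hs _, ?_, ?_, ?_⟩
    · rw [coeff_polynomialOfCoeffs]
      intro h
      rw [map_sub, map_mul, MvPolynomial.aeval_X, h, zero_mul, map_one, zero_sub,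
        neg_eq_zero] at h₁
      exact one_ne_zero h₁
    · rw [coeff_polynomialOfCoeffs]
      intro h
      rw [map_sub, map_mul, MvPolynomial.aeval_X, h, zero_mul, map_one, zero_sub,
        neg_eq_zero] at h₂
      exact one_ne_zero h₂
    · rw [← sub_eq_zero]
      ext d
      rw [← key]
      exact ha _ (.inl ⟨d, rfl⟩)
  · rintro ⟨g, h, hg, hh, hm, hm', e⟩
    refine ⟨Sum.elim (fun i => g.coeff i.1) (Sum.elim (fun i => h.coeff i.1)
      (fun b => if b then (g.coeff m)⁻¹ else (h.coeff m')⁻¹)), ?_⟩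
    rintro _ (⟨d, rfl⟩ | rfl | rfl)
    · refine (key _ d).trans ?_
      change (polynomialOfCoeffs s (fun i => g.coeff i.1) *
        polynomialOfCoeffs s (fun i => h.coeff i.1) - _).coeff d = 0
      rw [polynomialOfCoeffs_coeff s g hg, polynomialOfCoeffs_coeff s h hh, e, sub_self,
        MvPolynomial.coeff_zero]
    · rw [map_sub, map_mul, MvPolynomial.aeval_X, MvPolynomial.aeval_X, map_one, sub_eq_zero]
      exact mul_inv_cancel₀ hm
    · rw [map_sub, map_mul, MvPolynomial.aeval_X, MvPolynomial.aeval_X, map_one, sub_eq_zero]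
      exact mul_inv_cancel₀ hm'

theorem isUnit_iff_forall_coeff {T : Type u} [Field T] (g : MvPolynomial σ T) :
    IsUnit g ↔ g ≠ 0 ∧ ∀ m ≠ 0, g.coeff m = 0 := by
  classical
  rw [MvPolynomial.isUnit_iff_eq_C_of_isReduced]
  constructor
  · rintro ⟨r, hr, rfl⟩
    refine ⟨by simpa using hr.ne_zero, fun m hm => ?_⟩
    rw [MvPolynomial.coeff_C, if_neg hm.symm]
  · rintro ⟨h0, hm⟩
    have : g = MvPolynomial.C (g.coeff 0) := by
      ext m
      rw [MvPolynomial.coeff_C]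
      split_ifs with h
      · rw [h]
      · exact hm m (Ne.symm h)
    refine ⟨g.coeff 0, ?_, this⟩
    rw [isUnit_iff_ne_zero]
    intro h
    rw [h, MvPolynomial.C_0] at this
    exact h0 this

/-- A nontrivial factorization has two factors, each with a nonzero coefficient at a nonconstant
monomial. The exponents are bounded independently of the field, so finitely many systems of
equations detect reducibility. -/
theorem eventually_irreducible [Finite σ] {k : Type u} [Field k] [IsAlgClosed k] [Algebra R k]
    (p : MvPolynomial σ R) (hp : Irreducible (MvPolynomial.map (algebraMap R k) p)) :
    Eventually R k (fun T _ _ => IsField T → Irreducible (MvPolynomial.map (algebraMap R T) p)) := by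
  classical
  -- A nonconstant coefficient that survives in `T` keeps the polynomial from becoming zero or a
  -- unit.
  obtain ⟨m₀, hm₀, hpm₀⟩ : ∃ m ≠ 0, algebraMap R k (p.coeff m) ≠ 0 := by
    by_contra! h
    exact hp.not_isUnit ((isUnit_iff_forall_coeff _).mpr ⟨hp.ne_zero, fun m hm => by
      rw [MvPolynomial.coeff_map, h m hm]⟩)
  -- This box contains the support of every factor, since over a field total degrees add and that of
  -- `p` cannot increase.
  let s : Finset (σ →₀ ℕ) := Finset.Icc 0 (Finsupp.equivFunOnFinite.symm fun _ => p.totalDegree)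
  have h₁ (m : {m : s × s // m.1.1 ≠ 0 ∧ m.2.1 ≠ 0}) :
      ¬ ∃ a : s ⊕ s ⊕ Bool → k, ∀ e ∈ factorizationEquations p s m.1.1 m.1.2,
        MvPolynomial.aeval a e = 0 := by
    rw [exists_factorizationEquations_iff]
    rintro ⟨g, h, -, -, hg, hh, e⟩
    rcases hp.isUnit_or_isUnit e.symm with h' | h'
    · exact hg (((isUnit_iff_forall_coeff _).mp h').2 _ m.2.1)
    · exact hh (((isUnit_iff_forall_coeff _).mp h').2 _ m.2.2)
  refine ((Eventually.forall_finite fun m => eventually_no_solution _ (h₁ m)).and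
    (eventually_ne_zero _ hpm₀)).mono fun T _ _ hT hf => ?_
  let := hf.toField
  obtain ⟨hT, hT'⟩ := hT
  replace hT' := hT' inferInstance
  have hs (g h : MvPolynomial σ T) (e : g * h = MvPolynomial.map (algebraMap R T) p) (hg : g ≠ 0)
      (hh : h ≠ 0) : g.support ⊆ s := by
    intro d hd
    refine Finset.mem_Icc.mpr ⟨zero_le, fun i => ?_⟩
    have h₂ : g.totalDegree ≤ p.totalDegree := by
      have h₃ : (MvPolynomial.map (algebraMap R T) p).totalDegree ≤ p.totalDegree :=
        Finset.sup_mono (MvPolynomial.support_map_subset (algebraMap R T) p)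
      refine le_trans ?_ h₃
      rw [← e, MvPolynomial.totalDegree_mul_of_isDomain hg hh]
      exact Nat.le_add_right _ _
    refine le_trans ?_ ((MvPolynomial.le_totalDegree hd).trans h₂)
    by_cases hi : d i = 0
    · rw [hi]; exact Nat.zero_le _
    · exact Finset.single_le_sum (f := fun i => d i) (fun _ _ => Nat.zero_le _)
        (Finsupp.mem_support_iff.mpr hi)
  have hp0 : MvPolynomial.map (algebraMap R T) p ≠ 0 := by
    intro h
    refine hT' ?_
    rw [← MvPolynomial.coeff_map, h, MvPolynomial.coeff_zero]
  refine ⟨fun h => ?_, fun g h e => ?_⟩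
  · refine hT' ?_
    rw [← MvPolynomial.coeff_map]
    exact ((isUnit_iff_forall_coeff _).mp h).2 _ hm₀
  · by_contra! hn
    rw [e] at hp0
    have hg := left_ne_zero_of_mul hp0
    have hh := right_ne_zero_of_mul hp0
    rw [isUnit_iff_forall_coeff, isUnit_iff_forall_coeff] at hn
    push Not at hn
    obtain ⟨m, hm, hgm⟩ := hn.1 hg
    obtain ⟨m', hm', hhm⟩ := hn.2 hh
    have hgs := hs g h e.symm hg hh
    have hhs := hs h g (by rw [mul_comm, e]) hh hg
    refine hT ⟨(⟨m, hgs (MvPolynomial.mem_support_iff.mpr hgm)⟩,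
      ⟨m', hhs (MvPolynomial.mem_support_iff.mpr hhm)⟩), hm, hm'⟩ inferInstance ?_
    rw [exists_factorizationEquations_iff]
    exact ⟨g, h, hgs, hhs, hgm, hhm, e.symm⟩

end

/-! ### Principal open subsets of affine hypersurfaces -/

/-- The ring of functions on the open subset `g ≠ 0` of the affine hypersurface `p = 0`. -/
abbrev HypersurfaceRing {R : Type u} [CommRing R] {σ : Type} (p g : MvPolynomial σ R) : Type u :=
  Localization.Away (Ideal.Quotient.mk (Ideal.span {p}) g)

namespace HypersurfaceRing

variable {R : Type u} [CommRing R] {σ : Type} (p g : MvPolynomial σ R)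

/-- The coordinate functions. -/
def gen (i : σ) : HypersurfaceRing p g :=
  algebraMap (MvPolynomial σ R ⧸ Ideal.span {p}) _ (Ideal.Quotient.mk _ (MvPolynomial.X i))

theorem aeval_gen (q : MvPolynomial σ R) : MvPolynomial.aeval (gen p g) q =
    algebraMap (MvPolynomial σ R ⧸ Ideal.span {p}) (HypersurfaceRing p g)
      (Ideal.Quotient.mk _ q) := by
  have : MvPolynomial.aeval (gen p g) = (IsScalarTower.toAlgHom R
      (MvPolynomial σ R ⧸ Ideal.span {p}) (HypersurfaceRing p g)).comp
        (Ideal.Quotient.mkₐ R (Ideal.span {p})) := by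
    ext i
    simp [gen]
  rw [this]
  rfl

theorem aeval_gen_eq_zero : MvPolynomial.aeval (gen p g) p = 0 := by
  rw [aeval_gen, Ideal.Quotient.eq_zero_iff_mem.mpr (Ideal.mem_span_singleton_self p), map_zero]

theorem isUnit_aeval_gen : IsUnit (MvPolynomial.aeval (gen p g) g) := by
  rw [aeval_gen]
  exact IsLocalization.Away.algebraMap_isUnit _

variable {p g}
variable {A : Type*} [CommRing A] [Algebra R A]

/-- The universal property of the ring of functions. -/
def lift (a : σ → A) (hp : MvPolynomial.aeval a p = 0) (hg : IsUnit (MvPolynomial.aeval a g)) :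
    HypersurfaceRing p g →ₐ[R] A :=
  IsLocalization.Away.liftAlgHom (Ideal.Quotient.mk (Ideal.span {p}) g)
    (f := Ideal.Quotient.liftₐ (Ideal.span {p}) (MvPolynomial.aeval a) (fun _ hx =>
      (Ideal.span_le (I := RingHom.ker (MvPolynomial.aeval a))).mpr
        (Set.singleton_subset_iff.mpr hp) hx)) hg

@[simp]
theorem lift_gen (a : σ → A) (hp : MvPolynomial.aeval a p = 0)
    (hg : IsUnit (MvPolynomial.aeval a g)) (i : σ) : lift a hp hg (gen p g i) = a i :=
  (IsLocalization.Away.lift_eq (S := HypersurfaceRing p g)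
    (Ideal.Quotient.mk (Ideal.span {p}) g) hg _).trans (MvPolynomial.aeval_X a i)

theorem hom_ext {φ ψ : HypersurfaceRing p g →ₐ[R] A} (h : ∀ i, φ (gen p g i) = ψ (gen p g i)) :
    φ = ψ := by
  refine IsLocalization.algHom_ext (Submonoid.powers (Ideal.Quotient.mk (Ideal.span {p}) g)) ?_
  refine Ideal.Quotient.algHom_ext _ (MvPolynomial.algHom_ext fun i => h i)

instance [Finite σ] : Algebra.FinitePresentation R (HypersurfaceRing p g) := by
  have : Algebra.FinitePresentation R (MvPolynomial σ R ⧸ Ideal.span {p}) :=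
    .quotient (Submodule.fg_span (Set.finite_singleton p))
  have : Algebra.FinitePresentation (MvPolynomial σ R ⧸ Ideal.span {p}) (HypersurfaceRing p g) :=
    IsLocalization.Away.finitePresentation (Ideal.Quotient.mk (Ideal.span {p}) g)
  exact .trans R (MvPolynomial σ R ⧸ Ideal.span {p}) _

variable (p g) in
/-- Compatibility of the ring of functions with base change. -/
def baseChangeEquiv (T : Type u) [CommRing T] [Algebra R T] :
    T ⊗[R] HypersurfaceRing p g ≃ₐ[T] HypersurfaceRing (MvPolynomial.map (algebraMap R T) p)
      (MvPolynomial.map (algebraMap R T) g) :=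
  have h₁ (q : MvPolynomial σ R) : MvPolynomial.aeval (R := T)
      (fun i => (1 : T) ⊗ₜ[R] gen p g i) (MvPolynomial.map (algebraMap R T) q) =
      1 ⊗ₜ MvPolynomial.aeval (gen p g) q := by
    rw [MvPolynomial.aeval_map_algebraMap]
    exact (DFunLike.congr_fun (MvPolynomial.comp_aeval (gen p g)
      (Algebra.TensorProduct.includeRight (R := R) (A := T))) q).symm
  AlgEquiv.ofAlgHom
    (Algebra.TensorProduct.lift (Algebra.ofId T _) (lift (gen _ _)
      (by rw [← MvPolynomial.aeval_map_algebraMap T, aeval_gen_eq_zero])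
      (by rw [← MvPolynomial.aeval_map_algebraMap T]; exact isUnit_aeval_gen _ _))
      (fun _ _ => Commute.all _ _))
    (lift (fun i => 1 ⊗ₜ gen p g i)
      (by rw [h₁, aeval_gen_eq_zero, TensorProduct.tmul_zero])
      (by rw [h₁]; exact (isUnit_aeval_gen p g).map Algebra.TensorProduct.includeRight))
    (by
      refine hom_ext fun i => ?_
      simp)
    (by
      refine Algebra.TensorProduct.ext (by ext) (hom_ext fun i => ?_)
      simp)

/-- The canonical map to a base change. -/
def toBaseChange (T : Type u) [CommRing T] [Algebra R T] :
    HypersurfaceRing p g →ₐ[R] HypersurfaceRing (MvPolynomial.map (algebraMap R T) p)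
      (MvPolynomial.map (algebraMap R T) g) :=
  ((baseChangeEquiv p g T).toAlgHom.restrictScalars R).comp Algebra.TensorProduct.includeRight

theorem isPushout (T : Type u) [CommRing T] [Algebra R T] :
    letI := (toBaseChange (p := p) (g := g) T).toRingHom.toAlgebra
    Algebra.IsPushout R T (HypersurfaceRing p g) (HypersurfaceRing
      (MvPolynomial.map (algebraMap R T) p) (MvPolynomial.map (algebraMap R T) g)) := by
  let := (toBaseChange (p := p) (g := g) T).toRingHom.toAlgebra
  have : IsScalarTower R (HypersurfaceRing p g) (HypersurfaceRing
      (MvPolynomial.map (algebraMap R T) p) (MvPolynomial.map (algebraMap R T) g)) :=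
    IsScalarTower.of_algebraMap_eq fun r => ((toBaseChange (p := p) (g := g) T).commutes r).symm
  exact isPushout_of_algEquiv (baseChangeEquiv p g T) fun b => rfl

theorem isPullback (p g : MvPolynomial σ R) (T : Type u) [CommRing T] [Algebra R T] :
    IsPullback (specMapHom (toBaseChange (p := p) (g := g) T)) (specMap T (HypersurfaceRing
      (MvPolynomial.map (algebraMap R T) p) (MvPolynomial.map (algebraMap R T) g)))
      (specMap R (HypersurfaceRing p g)) (specMap R T) := by
  let := (toBaseChange (p := p) (g := g) T).toRingHom.toAlgebra
  have : IsScalarTower R (HypersurfaceRing p g) (HypersurfaceRing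
      (MvPolynomial.map (algebraMap R T) p) (MvPolynomial.map (algebraMap R T) g)) :=
    IsScalarTower.of_algebraMap_eq fun r => ((toBaseChange (p := p) (g := g) T).commutes r).symm
  have := isPushout (p := p) (g := g) T
  exact (isPullback_specMap R T (HypersurfaceRing p g) (HypersurfaceRing
      (MvPolynomial.map (algebraMap R T) p) (MvPolynomial.map (algebraMap R T) g)))

/-- The base change of the open subset of a hypersurface. -/
def bcIso (p g : MvPolynomial σ R) (T : Type u) [CommRing T] [Algebra R T] :
    Spec (CommRingCat.of (HypersurfaceRing (MvPolynomial.map (algebraMap R T) p)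
      (MvPolynomial.map (algebraMap R T) g))) ≅ bc (specMap R (HypersurfaceRing p g)) T :=
  (isPullback p g T).isoPullback

theorem nontrivial_of_nonempty (h : Nonempty (Spec (CommRingCat.of (HypersurfaceRing p g)))) :
    Nontrivial (HypersurfaceRing p g) :=
  PrimeSpectrum.nonempty_iff_nontrivial.mp h

/-- An irreducible polynomial is prime, and `g` is nonzero modulo it because the localization is
nontrivial; so the localization is a domain. -/
theorem irreducibleSpace {K : Type u} [Field K] {p g : MvPolynomial σ K} (hp : Irreducible p)
    (hn : Nontrivial (HypersurfaceRing p g)) :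
    IrreducibleSpace (Spec (CommRingCat.of (HypersurfaceRing p g))) := by
  have h₁ : (Ideal.span {p}).IsPrime :=
    (Ideal.span_singleton_prime hp.ne_zero).mpr hp.prime
  have : IsDomain (HypersurfaceRing p g) := by
    refine IsLocalization.isDomain_localization (M := Submonoid.powers _) ?_
    refine powers_le_nonZeroDivisors_of_noZeroDivisors fun h => ?_
    have := IsLocalization.Away.algebraMap_isUnit (S := HypersurfaceRing p g)
      (Ideal.Quotient.mk (Ideal.span {p}) g)
    exact not_isUnit_zero (by simpa only [h, map_zero] using this)
  exact inferInstanceAs (IrreducibleSpace (PrimeSpectrum (HypersurfaceRing p g)))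

end HypersurfaceRing

/-- Every field `K` over `T` is itself an algebra over the stage `S`, so `p` remains irreducible and
the open set nonempty over `K`. -/
theorem eventually_geometricallyIrreducible {R k : Type u} [CommRing R] [Field k] [IsAlgClosed k]
    [Algebra R k] {σ : Type} [Finite σ] (p g : MvPolynomial σ R)
    (hp : Irreducible (MvPolynomial.map (algebraMap R k) p))
    (hn : Nontrivial (HypersurfaceRing (MvPolynomial.map (algebraMap R k) p)
      (MvPolynomial.map (algebraMap R k) g))) :
    Eventually R k (fun T _ _ => GeometricallyIrreducible (specMap T (HypersurfaceRing
      (MvPolynomial.map (algebraMap R T) p) (MvPolynomial.map (algebraMap R T) g)))) := by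
  have : Nonempty (bc (specMap R (HypersurfaceRing p g)) k) :=
    Nonempty.map (HypersurfaceRing.bcIso p g k).hom (inferInstanceAs (Nonempty (PrimeSpectrum _)))
  have : LocallyOfFinitePresentation (specMap R (HypersurfaceRing p g)) := by
    rw [HasRingHomProperty.Spec_iff (P := @LocallyOfFinitePresentation)]
    exact RingHom.finitePresentation_algebraMap.mpr inferInstance
  obtain ⟨S, hS, h⟩ := (eventually_irreducible p hp).and
    (eventually_nonempty (k := k) (specMap R (HypersurfaceRing p g)))
  refine ⟨S, hS, fun T _ _ φ => ?_⟩
  refine (geometricallyIrreducible_iff _).mpr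
    (geometrically_iff_of_commRing_of_isClosedUnderIsomorphisms.mpr fun K _ _ => ?_)
  let : Algebra R K := ((algebraMap T K).comp (algebraMap R T)).toAlgebra
  have : IsScalarTower R T K := IsScalarTower.of_algebraMap_eq fun _ => rfl
  obtain ⟨h₁, h₂⟩ := h K ((IsScalarTower.toAlgHom R T K).comp φ)
  replace h₁ := h₁ (Field.toIsField K)
  replace h₂ := h₂ inferInstance
  have h₃ := HypersurfaceRing.irreducibleSpace h₁ (HypersurfaceRing.nontrivial_of_nonempty
    (h₂.map (HypersurfaceRing.bcIso p g K).inv))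
  rw [IsScalarTower.algebraMap_eq R T K, ← MvPolynomial.map_map, ← MvPolynomial.map_map] at h₃
  exact ObjectProperty.prop_of_iso (fun X : Scheme.{u} => IrreducibleSpace X)
    (HypersurfaceRing.bcIso _ _ K) h₃

/-! ### Smooth algebras are locally open subsets of irreducible hypersurfaces -/

section

variable {k : Type u} [Field k] {n : ℕ}

/-- Coordinates on an algebra over a polynomial ring, together with a further element. -/
def optionCoordinates {D : Type*} [CommRing D] [Algebra (MvPolynomial (Fin n) k) D] (y : D) :
    Option (Fin n) → D :=
  fun i => i.elim y fun i => algebraMap (MvPolynomial (Fin n) k) D (MvPolynomial.X i)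

theorem aeval_optionCoordinates {D : Type*} [CommRing D] [Algebra k D]
    [Algebra (MvPolynomial (Fin n) k) D] [IsScalarTower k (MvPolynomial (Fin n) k) D] (y : D)
    (p : MvPolynomial (Option (Fin n)) k) :
    MvPolynomial.aeval (optionCoordinates (k := k) y) p =
      Polynomial.aeval y (MvPolynomial.optionEquivLeft k (Fin n) p) := by
  have : MvPolynomial.aeval (optionCoordinates (k := k) y) = ((Polynomial.aeval
      (R := MvPolynomial (Fin n) k) y).restrictScalars k).comp
        (MvPolynomial.optionEquivLeft k (Fin n)).toAlgHom := by
    ext i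
    cases i <;> simp [optionCoordinates]
  rw [this]
  rfl

/-- A prime of a standard étale algebra over a unique factorization domain is contained in a
unique irreducible component, defined by an irreducible factor of the polynomial. -/
theorem exists_irreducible_factor {A C : Type*} [CommRing A] [IsDomain A]
    [UniqueFactorizationMonoid A] [CommRing C] [Algebra A C] (P : StandardEtalePair A) {x : C}
    (hx : P.HasMap x) (q : Ideal C) [q.IsPrime] :
    ∃ f h : Polynomial A, Irreducible f ∧ f * h = P.f ∧ Polynomial.aeval x h ∉ q := by
  let Q : Ideal (Polynomial A) := q.comap (Polynomial.aeval (R := A) x)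
  have hQ : Q.IsPrime := inferInstance
  obtain ⟨s, hs, hsF⟩ := UniqueFactorizationMonoid.exists_prime_factors P.f P.monic_f.ne_zero
  have hF : P.f ∈ Q := by
    rw [Ideal.mem_comap, hx.1]
    exact zero_mem _
  obtain ⟨f, hf, hfQ⟩ := (hQ.multiset_prod_mem_iff_exists_mem s).mp
    (Q.mem_of_dvd hsF.symm.dvd hF)
  obtain ⟨h, hh⟩ := (Multiset.dvd_prod hf).trans hsF.dvd
  refine ⟨f, h, (hs f hf).irreducible, hh.symm, fun hhq => ?_⟩
  -- If both `f` and `h` vanished at `q`, so would the derivative of their product; but that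
  -- derivative is a unit.
  have hu := hx.isUnit_derivative_f
  refine ‹q.IsPrime›.ne_top (q.eq_top_of_isUnit_mem ?_ hu)
  rw [hh, Polynomial.derivative_mul, map_add, map_mul, map_mul]
  exact add_mem (Ideal.mul_mem_left _ _ hhq) (Ideal.mul_mem_right _ _ hfQ)

/-- In `C` the relation is `F * H = 0` with `P.g` inverted. Inverting `H` as well leaves `F = 0`
with `P.g * H` invertible, which is the universal property that `lift` and `ext` record for `D`. -/
theorem nonempty_algEquiv_of_isStandardEtale {C D : Type u} [CommRing C] [CommRing D] [Algebra k C]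
    [Algebra k D] [Algebra (MvPolynomial (Fin n) k) C] [IsScalarTower k (MvPolynomial (Fin n) k) C]
    (P : StandardEtalePresentation (MvPolynomial (Fin n) k) C)
    {F H : Polynomial (MvPolynomial (Fin n) k)} (hFH : F * H = P.f) (d : Option (Fin n) → D)
    (hd : MvPolynomial.aeval d ((MvPolynomial.optionEquivLeft k (Fin n)).symm F) = 0)
    (hd' : IsUnit (MvPolynomial.aeval d
      ((MvPolynomial.optionEquivLeft k (Fin n)).symm (P.g * H))))
    (lift : ∀ (E : Type u) [CommRing E] [Algebra k E] (a : Option (Fin n) → E),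
      MvPolynomial.aeval a ((MvPolynomial.optionEquivLeft k (Fin n)).symm F) = 0 →
      IsUnit (MvPolynomial.aeval a ((MvPolynomial.optionEquivLeft k (Fin n)).symm (P.g * H))) →
      ∃ φ : D →ₐ[k] E, ∀ i, φ (d i) = a i)
    (ext : ∀ φ ψ : D →ₐ[k] D, (∀ i, φ (d i) = ψ (d i)) → φ = ψ) :
    Nonempty (Localization.Away (Polynomial.aeval P.x H) ≃ₐ[k] D) := by
  let ε := MvPolynomial.optionEquivLeft k (Fin n)
  let h := Polynomial.aeval P.x H
  let : Algebra (MvPolynomial (Fin n) k) D :=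
    (MvPolynomial.aeval (fun i => d (some i))).toRingHom.toAlgebra
  have : IsScalarTower k (MvPolynomial (Fin n) k) D := IsScalarTower.of_algebraMap_eq fun r =>
    (AlgHom.commutes (MvPolynomial.aeval (fun i => d (some i))) r).symm
  have hgen : optionCoordinates (k := k) (d none) = d := by
    funext i
    cases i with
    | none => rfl
    | some i => exact MvPolynomial.aeval_X _ i
  have hD (f : Polynomial (MvPolynomial (Fin n) k)) : Polynomial.aeval (d none) f =
      MvPolynomial.aeval d (ε.symm f) := by
    conv_rhs => rw [← hgen, aeval_optionCoordinates]
    exact congrArg _ (ε.apply_symm_apply f).symm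
  have hgu : IsUnit (Polynomial.aeval (d none) P.g * Polynomial.aeval (d none) H) := by
    rw [← map_mul, hD]
    exact hd'
  have hy : P.P.HasMap (d none) := by
    refine ⟨?_, isUnit_of_mul_isUnit_left hgu⟩
    rw [← hFH, map_mul, hD, hd, zero_mul]
  let ψ₀ : C →ₐ[MvPolynomial (Fin n) k] D := (P.P.lift (d none) hy).comp P.equivRing.toAlgHom
  have hψ₀ : ψ₀ P.x = d none := by simp [ψ₀]
  have hψh : IsUnit (ψ₀ h) := by
    rw [← Polynomial.aeval_algHom_apply, hψ₀]
    exact isUnit_of_mul_isUnit_right hgu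
  let ψ : Localization.Away h →ₐ[MvPolynomial (Fin n) k] D :=
    IsLocalization.Away.liftAlgHom h (f := ψ₀) hψh
  have hψ (c : C) : ψ (algebraMap C _ c) = ψ₀ c := IsLocalization.Away.lift_eq h hψh c
  let x : Localization.Away h := algebraMap C _ P.x
  have hE (f : Polynomial (MvPolynomial (Fin n) k)) :
      MvPolynomial.aeval (optionCoordinates (k := k) x) (ε.symm f) =
      algebraMap C (Localization.Away h) (Polynomial.aeval P.x f) := by
    rw [aeval_optionCoordinates, ← Polynomial.aeval_algebraMap_apply]
    exact congrArg _ (ε.apply_symm_apply f)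
  have hu : IsUnit (algebraMap C (Localization.Away h) h) :=
    IsLocalization.Away.algebraMap_isUnit h
  obtain ⟨φ, hφ⟩ := lift (Localization.Away h) (optionCoordinates (k := k) x)
    (by
      rw [hE]
      have h₁ := P.hasMap.1
      rw [← hFH, map_mul] at h₁
      have h₂ := congrArg (algebraMap C (Localization.Away h)) h₁
      rw [map_mul, map_zero] at h₂
      exact hu.mul_left_eq_zero.mp h₂)
    (by
      rw [hE, map_mul, map_mul]
      exact (P.hasMap.2.map _).mul hu)
  let φ' : D →ₐ[MvPolynomial (Fin n) k] Localization.Away h := { φ with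
    commutes' := fun a => by
      have : φ.comp (MvPolynomial.aeval (fun i => d (some i))) =
          IsScalarTower.toAlgHom k (MvPolynomial (Fin n) k) (Localization.Away h) := by
        ext i
        rw [AlgHom.comp_apply, MvPolynomial.aeval_X, hφ]
        rfl
      exact DFunLike.congr_fun this a }
  refine ⟨(AlgEquiv.ofAlgHom ψ φ' ?_ ?_).restrictScalars k⟩
  · apply AlgHom.restrictScalars_injective k
    refine ext _ _ fun i => ?_
    change ψ (φ (d i)) = d i
    rw [hφ]
    cases i with
    | none => exact (hψ _).trans hψ₀
    | some i => exact (ψ.commutes _).trans (MvPolynomial.aeval_X _ i)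
  · refine IsLocalization.algHom_ext (Submonoid.powers h) (P.hom_ext ?_)
    change φ (ψ (algebraMap C _ P.x)) = algebraMap C _ P.x
    rw [hψ, hψ₀]
    exact hφ none

/-- The irreducible factor of the defining polynomial that vanishes at `q` gives the hypersurface,
and inverting the cofactor removes the other components. -/
theorem exists_hypersurface_of_isStandardEtale {C : Type u} [CommRing C] [Algebra k C]
    [Algebra (MvPolynomial (Fin n) k) C] [IsScalarTower k (MvPolynomial (Fin n) k) C]
    [Algebra.IsStandardEtale (MvPolynomial (Fin n) k) C] (q : Ideal C) [q.IsPrime] :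
    ∃ (p g : MvPolynomial (Option (Fin n)) k) (h : C), Irreducible p ∧ h ∉ q ∧
      Nonempty (Localization.Away h ≃ₐ[k] HypersurfaceRing p g) := by
  obtain ⟨P⟩ :=
    (inferInstance : Nonempty (StandardEtalePresentation (MvPolynomial (Fin n) k) C))
  obtain ⟨F, H, hF, hFH, hH⟩ := exists_irreducible_factor P.P P.hasMap q
  let ε := MvPolynomial.optionEquivLeft k (Fin n)
  exact ⟨ε.symm F, ε.symm (P.g * H), _, (MulEquiv.irreducible_iff ε.symm.toMulEquiv).mpr hF, hH,
    nonempty_algEquiv_of_isStandardEtale P hFH (HypersurfaceRing.gen _ _)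
      (HypersurfaceRing.aeval_gen_eq_zero _ _) (HypersurfaceRing.isUnit_aeval_gen _ _)
      (fun E _ _ a ha ha' => ⟨HypersurfaceRing.lift a ha ha', HypersurfaceRing.lift_gen a ha ha'⟩)
      fun φ ψ h => HypersurfaceRing.hom_ext h⟩

end

/-- A smooth scheme over a field is covered by open subsets of irreducible hypersurfaces. -/
theorem exists_hypersurface_chart {k : Type u} [Field k] {n : ℕ} {Z : Scheme.{u}}
    (t : Z ⟶ Spec (CommRingCat.of k)) [SmoothOfRelativeDimension n t] (x : Z) :
    ∃ (σ : Type) (_ : Finite σ) (p g : MvPolynomial σ k) (_ : Irreducible p)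
      (j : Spec (CommRingCat.of (HypersurfaceRing p g)) ⟶ Z), IsOpenImmersion j ∧
        j ≫ t = specMap k (HypersurfaceRing p g) ∧ x ∈ Set.range j := by
  obtain ⟨B, _, _, _, j, _, hj, x, rfl⟩ := exists_standardSmooth_chart (n := n) t x
  have : Algebra.IsStandardSmooth k B :=
    Algebra.IsStandardSmoothOfRelativeDimension.isStandardSmooth n
  have hx : x.asIdeal.IsPrime := PrimeSpectrum.isPrime x
  -- Near the point, a smooth algebra is standard étale over a polynomial ring in `m` variables.
  obtain ⟨f, hf, m, _, _, _⟩ :=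
    Algebra.IsSmoothAt.exists_isStandardEtale_mvPolynomial (R := k) (p := x.asIdeal)
  let C := Localization.Away f
  obtain ⟨y, rfl⟩ : x ∈ Set.range (specMap B C) :=
    (PrimeSpectrum.localization_away_comap_range C f).ge hf
  have hy : y.asIdeal.IsPrime := PrimeSpectrum.isPrime y
  obtain ⟨p, g, h, hp, hh, ⟨e⟩⟩ := exists_hypersurface_of_isStandardEtale (k := k) (n := m) (C := C) y.asIdeal
  obtain ⟨z, rfl⟩ : y ∈ Set.range (specMap C (Localization.Away h)) :=
    (PrimeSpectrum.localization_away_comap_range (Localization.Away h) h).ge hh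
  have h₁ : IsOpenImmersion (specMap B C) := IsOpenImmersion.of_isLocalization f
  have h₂ : IsOpenImmersion (specMap C (Localization.Away h)) := IsOpenImmersion.of_isLocalization h
  let i : Spec (CommRingCat.of (HypersurfaceRing p g)) ≅ Spec (CommRingCat.of (Localization.Away h)) :=
    Scheme.Spec.mapIso e.toRingEquiv.toCommRingCatIso.op
  refine ⟨Option (Fin m), inferInstance, p, g, hp,
    i.hom ≫ specMap C (Localization.Away h) ≫ specMap B C ≫ j, inferInstance, ?_, ?_⟩
  · simp only [Category.assoc, hj]
    rw [specMap_specMap, specMap_specMap]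
    exact specMapHom_specMap e.toAlgHom
  · refine ⟨i.inv z, ?_⟩
    rw [← Scheme.Hom.comp_apply, Iso.inv_hom_id_assoc]
    rfl

/-! ### Spreading out connectedness -/

section

theorem HypersurfaceRing.exists_isPullback {R : Type u} [CommRing R] {σ : Type}
    (p g : MvPolynomial σ R) (T : Type u) [CommRing T] [Algebra R T] :
    ∃ q, IsPullback q (specMap T (HypersurfaceRing (MvPolynomial.map (algebraMap R T) p)
      (MvPolynomial.map (algebraMap R T) g))) (specMap R (HypersurfaceRing p g)) (specMap R T) :=
  ⟨_, HypersurfaceRing.isPullback p g T⟩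

theorem exists_map_eq {R k : Type u} [CommRing R] [Field k] [Algebra R k] {σ : Type} (p : MvPolynomial σ k) :
    ∃ S : Subalgebra R k, S.FG ∧ ∃ p₀ : MvPolynomial σ S, MvPolynomial.map (algebraMap S k) p₀ = p := by
  classical
  refine ⟨Algebra.adjoin R (p.coeffs : Set k), ⟨p.coeffs, rfl⟩, ?_⟩
  obtain ⟨p₀, hp₀⟩ := (MvPolynomial.mem_range_map_iff_coeffs_subset
    (f := algebraMap (Algebra.adjoin R (p.coeffs : Set k)) k) (x := p)).mpr (by
    intro c hc
    exact ⟨⟨c, Algebra.subset_adjoin hc⟩, rfl⟩)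
  exact ⟨p₀, hp₀⟩

theorem isIrreducible_preimage {R S T : Type u} [CommRing R] {X : Scheme.{u}}
    (f : X ⟶ Spec (CommRingCat.of R)) [CommRing S] [Field T] [Algebra R S] [Algebra R T]
    (φ : S →ₐ[R] T) (V : (bc f S).Opens) (hV : GeometricallyIrreducible (V.ι ≫ bcTo f S)) :
    IsIrreducible ((bcMap f φ ⁻¹ᵁ V : (bc f T).Opens) : Set (bc f T)) := by
  have : IrreducibleSpace (bcMap f φ ⁻¹ᵁ V : (bc f T).Opens) :=
    hV.geometrically_irreducibleSpace _ _ _ (isPullback_opens_bcMap φ V)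
  have := (IrreducibleSpace.isIrreducible_univ (bcMap f φ ⁻¹ᵁ V : (bc f T).Opens)).image
    Subtype.val continuous_subtype_val.continuousOn
  convert this using 1
  exact Subtype.range_coe.symm.trans Set.image_univ.symm

variable {R k : Type u} [CommRing R] [Field k] [IsAlgClosed k] [Algebra R k]

theorem exists_stage_geometricallyIrreducible {σ : Type} [Finite σ] (p g : MvPolynomial σ k)
    (hp : Irreducible p) (hn : Nontrivial (HypersurfaceRing p g)) :
    ∃ S : Subalgebra R k, S.FG ∧ ∃ p₀ g₀ : MvPolynomial σ S,
      MvPolynomial.map (algebraMap S k) p₀ = p ∧ MvPolynomial.map (algebraMap S k) g₀ = g ∧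
        GeometricallyIrreducible (specMap S (HypersurfaceRing p₀ g₀)) := by
  obtain ⟨S₁, hS₁, p₁, rfl⟩ := exists_map_eq (R := R) p
  obtain ⟨S₂, hS₂, g₂, rfl⟩ := exists_map_eq (R := R) g
  let S := S₁ ⊔ S₂
  have hS : S.FG := hS₁.sup hS₂
  let p' := MvPolynomial.map (Subalgebra.inclusion (le_sup_left : S₁ ≤ S)).toRingHom p₁
  let g' := MvPolynomial.map (Subalgebra.inclusion (le_sup_right : S₂ ≤ S)).toRingHom g₂
  have hp' : MvPolynomial.map (algebraMap S k) p' = MvPolynomial.map (algebraMap S₁ k) p₁ :=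
    MvPolynomial.map_map _ _ _
  have hg' : MvPolynomial.map (algebraMap S k) g' = MvPolynomial.map (algebraMap S₂ k) g₂ :=
    MvPolynomial.map_map _ _ _
  rw [← hp'] at hp
  rw [← hp', ← hg'] at hn
  obtain ⟨S₃, hS₃, hf₃, h⟩ := (eventually_geometricallyIrreducible p' g' hp hn).exists_stage hS
  rw [← hp', ← hg']
  let := (Subalgebra.inclusion hS₃).toRingHom.toAlgebra
  exact ⟨S₃, hf₃, MvPolynomial.map (algebraMap S S₃) p', MvPolynomial.map (algebraMap S S₃) g',
    MvPolynomial.map_map _ _ _, MvPolynomial.map_map _ _ _, h⟩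

variable {X : Scheme.{u}} (f : X ⟶ Spec (CommRingCat.of R)) [QuasiCompact f] [QuasiSeparated f]
  [LocallyOfFinitePresentation f]

/-- A hypersurface chart around `x` is defined over a stage where it is already geometrically
irreducible, and this model is then identified with an open subset of a base change of `X`. -/
theorem exists_spread_geometricallyIrreducible (n : ℕ) [SmoothOfRelativeDimension n (bcTo f k)]
    (x : bc f k) : ∃ S : Subalgebra R k, S.FG ∧ ∃ V : (bc f S).Opens, x ∈ bcMap f S.val ⁻¹ᵁ V ∧
      GeometricallyIrreducible (V.ι ≫ bcTo f S) := by
  obtain ⟨σ, _, p, g, hp, j, _, hj, x, rfl⟩ := exists_hypersurface_chart (n := n) (bcTo f k) x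
  obtain ⟨S, hS, p₀, g₀, rfl, rfl, hQ⟩ := exists_stage_geometricallyIrreducible (R := R) p g hp
    (HypersurfaceRing.nontrivial_of_nonempty ⟨x⟩)
  have : LocallyOfFinitePresentation (specMap S (HypersurfaceRing p₀ g₀)) := by
    rw [HasRingHomProperty.Spec_iff (P := @LocallyOfFinitePresentation)]
    exact RingHom.finitePresentation_algebraMap.mpr inferInstance
  obtain ⟨q, hq⟩ := HypersurfaceRing.exists_isPullback p₀ g₀ k
  obtain ⟨S', hS', V, hV, h⟩ := exists_spread_of_isPullback (f := f) @GeometricallyIrreducible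
    j.opensRange (isCompact_range j.continuous) hS hQ (q := j.isoOpensRange.inv ≫ q)
    (hq.of_iso j.isoOpensRange (Iso.refl _) (Iso.refl _)
      (Iso.refl _) (by simp) (by
        rw [← Category.assoc, Scheme.Hom.isoOpensRange_hom_ι, hj, Iso.refl_hom, Category.comp_id])
      (by simp) (by simp))
  exact ⟨S', hS', V, hV.ge ⟨x, rfl⟩, h⟩

/-- Take a finite cover by opens with geometrically irreducible fibers. Connectedness over `k`
yields chains of overlapping charts; overlaps remain nonempty over `T`, so the same chains connect
the fiber there. -/
theorem eventually_connectedSpace (n : ℕ) [SmoothOfRelativeDimension n (bcTo f k)]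
    [ConnectedSpace (bc f k)] :
    Eventually R k (fun T _ _ => IsField T → ConnectedSpace (bc f T)) := by
  obtain ⟨S, hS, m, V, hV, hQ⟩ := exists_spread_cover (f := f) (k := k)
    @GeometricallyIrreducible (exists_spread_geometricallyIrreducible f n)
  let U (i) := bcMap f S.val ⁻¹ᵁ V i
  have hU : ⨆ i, U i = ⊤ := by
    rw [← Scheme.Hom.preimage_iSup, hV]
    rfl
  have hov (ij : {ij : Fin m × Fin m // ((U ij.1 : Set (bc f k)) ∩ U ij.2).Nonempty}) :
      Eventually S k (fun T _ _ => Nontrivial T →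
        Nonempty (bc ((V ij.1.1 ⊓ V ij.1.2).ι ≫ bcTo f S) T)) := by
    have : Nonempty (bc ((V ij.1.1 ⊓ V ij.1.2).ι ≫ bcTo f S) k) := by
      have := isPullback_opens_bcMap S.val (V ij.1.1 ⊓ V ij.1.2)
      obtain ⟨x, hx⟩ := ij.2
      exact ⟨this.isoPullback.hom ⟨x, hx⟩⟩
    exact eventually_nonempty _
  refine (Eventually.forall_finite hov).of_stage hS fun T _ _ _ _ hT hf => ?_
  let := hf.toField
  let φ : S →ₐ[R] T := IsScalarTower.toAlgHom R S T
  let W (i) := bcMap f φ ⁻¹ᵁ V i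
  have hW : ⋃ i, (W i : Set (bc f T)) = Set.univ := by
    rw [← Opens.coe_iSup, ← Scheme.Hom.preimage_iSup, hV]
    rfl
  have hm : Nonempty (Fin m) := by
    by_contra h
    rw [not_nonempty_iff] at h
    rw [iSup_of_empty] at hU
    obtain ⟨x⟩ := (inferInstance : Nonempty (bc f k))
    exact (hU.ge (Opens.mem_top x) : x ∈ (⊥ : (bc f k).Opens))
  have hWW (i j) (h : ((U i : Set (bc f k)) ∩ U j).Nonempty) :
      ((W i : Set (bc f T)) ∩ W j).Nonempty := by
    obtain ⟨x⟩ := hT ⟨(i, j), h⟩ inferInstance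
    have := isPullback_opens_bcMap φ (V i ⊓ V j)
    exact ⟨_, (this.isoPullback.inv x).2⟩
  have hirr (i) := isIrreducible_preimage f φ (V i) (hQ i)
  have hirr' (i) := isIrreducible_preimage f S.val (V i) (hQ i)
  have hconn : _root_.IsPreconnected (⋃ i, (U i : Set (bc f k))) := by
    rw [← Opens.coe_iSup, hU]
    exact isPreconnected_univ
  -- Members of an open cover of a connected space by nonempty sets are linked by chains of
  -- overlaps; here these chains are carried from the `U i` to the `W i`.
  have hpre : _root_.IsPreconnected (⋃ i, (W i : Set (bc f T))) :=
    IsPreconnected.iUnion_of_reflTransGen (fun i => (hirr i).isPreirreducible.isPreconnected)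
      fun i j => Relation.ReflTransGen.mono hWW _ _ (hconn.transGen_of_iUnion
        (fun i => (U i).isOpen) i j (hirr' i).nonempty (hirr' j).nonempty).to_reflTransGen
  rw [hW] at hpre
  have : PreconnectedSpace (bc f T) := ⟨hpre⟩
  have : Nonempty (bc f T) := ⟨(hirr hm.some).nonempty.some⟩
  exact { toNonempty := this }

end

/-! ### Specialization to the algebraic numbers -/

/-- A weak form of the Nullstellensatz. -/
theorem nonempty_algHom_of_finiteType (F M K : Type*) [Field F] [CommRing M] [Nontrivial M]
    [Algebra F M] [Algebra.FiniteType F M] [Field K] [IsAlgClosed K] [Algebra F K] :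
    Nonempty (M →ₐ[F] K) := by
  obtain ⟨m, hm⟩ := Ideal.exists_maximal M
  let := Ideal.Quotient.field m
  have : Module.Finite F (M ⧸ m) := finite_of_finite_type_of_isJacobsonRing _ _
  exact ⟨(IsAlgClosed.lift (R := F) (M := K) (S := M ⧸ m)).comp (Ideal.Quotient.mkₐ F m)⟩

/-- A nonzero element of a domain of finite type over a subring of a field `F` stays nonzero under
some homomorphism to a given algebraically closed extension of `F`. -/
theorem exists_ringHom_ne_zero {R S : Type*} (F K : Type*) [CommRing R] [CommRing S] [IsDomain R]
    [IsDomain S] [Field F] [Algebra R F] [FaithfulSMul R F] [Algebra R S] [FaithfulSMul R S]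
    [Algebra.FiniteType R S] [Field K] [IsAlgClosed K] [Algebra F K] {b : S} (hb : b ≠ 0) :
    ∃ ψ : S →+* K, ψ b ≠ 0 := by
  let M := Localization.Away b
  have hM : Submonoid.powers b ≤ nonZeroDivisors S := powers_le_nonZeroDivisors_of_noZeroDivisors hb
  have : IsDomain M := IsLocalization.isDomain_localization hM
  have : Algebra.FiniteType S M := IsLocalization.finiteType_of_monoid_fg (Submonoid.powers b) M
  have : Algebra.FiniteType R M := Algebra.FiniteType.trans ‹Algebra.FiniteType R S› this
  have hinj : Function.Injective (algebraMap R M) := by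
    rw [IsScalarTower.algebraMap_eq R S M]
    exact (IsLocalization.injective M hM).comp (FaithfulSMul.algebraMap_injective R S)
  -- `R` embeds in the field `F` and in the domain `M`, so the tensor product does not vanish.
  have : Nontrivial (F ⊗[R] M) :=
    Algebra.TensorProduct.nontrivial_of_algebraMap_injective_of_isDomain R F M
      (FaithfulSMul.algebraMap_injective R F) hinj
  obtain ⟨χ⟩ := nonempty_algHom_of_finiteType F (F ⊗[R] M) K
  let ψ : M →+* K := χ.toRingHom.comp Algebra.TensorProduct.includeRight.toRingHom
  exact ⟨ψ.comp (algebraMap S M), ((IsLocalization.Away.algebraMap_isUnit b).map ψ).ne_zero⟩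

theorem surjective_residueFieldMap {X Y : Scheme.{u}} (f : X ⟶ Y) [IsClosedImmersion f] (x : X) :
    Function.Surjective (f.residueFieldMap x).hom := by
  have h := congrArg CommRingCat.Hom.hom (Scheme.residue_residueFieldMap f x)
  have hs : Function.Surjective ((f.stalkMap x ≫ X.residue x).hom) :=
    (X.residue_surjective x).comp (f.stalkMap_surjective x)
  rw [← h, CommRingCat.hom_comp, RingHom.coe_comp] at hs
  exact Function.Surjective.of_comp hs

theorem IsProjective.of_iso {X Y S : Scheme.{u}} {f : X ⟶ S} {g : Y ⟶ S} (e : Y ≅ X)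
    (he : e.hom ≫ f = g) (hf : IsProjective f) : IsProjective g := by
  obtain ⟨N, i, hi, rfl⟩ := hf
  exact ⟨N, e.hom ≫ i, inferInstance, by rw [Category.assoc, he]⟩

/-- If the generic part of a family over a finitely generated ring `A` satisfies the hypotheses of
the conjecture over a field `K` for which the conjecture holds, then the conclusion holds for some
closed point of each basic open set of `Spec A` that meets the image of `Spec K`. -/
theorem FrobeniusConjecture.exists_mem_basicOpen {K : Type u} [Field K] (hK : FrobeniusConjecture K)
    {A : Type u} [CommRing A] [Algebra.FiniteType ℤ A] [Algebra A K] {X : Scheme.{u}}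
    (f : X ⟶ Spec (CommRingCat.of A)) [LocallyOfFiniteType f] [QuasiCompact f] [Flat f] (n : ℕ)
    (h₁ : IsProjective (bcTo f K)) (h₂ : SmoothOfRelativeDimension n (bcTo f K))
    (h₃ : ConnectedSpace (bc f K)) {b : A} (hb : algebraMap A K b ≠ 0) :
    ∃ s : Spec (CommRingCat.of A), s ∈ PrimeSpectrum.basicOpen b ∧
      IsClosed ({s} : Set (Spec (CommRingCat.of A))) ∧ FrobeniusBijectiveOnFiber f s n := by
  -- The map from `A` to `K` may have a kernel, so the conjecture is applied to a model over its
  -- image.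
  let B : Subring K := (algebraMap A K).range
  let : Algebra A B := (algebraMap A K).rangeRestrict.toAlgebra
  have hAB : Function.Surjective (algebraMap A B) := (algebraMap A K).rangeRestrict_surjective
  have : IsScalarTower A B K := IsScalarTower.of_algebraMap_eq fun _ => rfl
  have hB : Algebra.FiniteType ℤ B :=
    Algebra.FiniteType.of_surjective (IsScalarTower.toAlgHom ℤ A B) hAB
  have hmodel : IsModel (bcTo f K) B (bcTo f B) (bcMap f (IsScalarTower.toAlgHom A B K)) :=
    { locallyOfFiniteType := inferInstance
      quasiCompact := inferInstance
      flat := inferInstance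
      isPullback := isPullback_bcMap f (IsScalarTower.toAlgHom A B K) }
  obtain ⟨Z, hZ, hgood⟩ := hK n _ _ h₁ h₂ h₃ B hB _ _ _ hmodel
  have : IsClosedImmersion (specMap A B) := IsClosedImmersion.spec_of_surjective _ hAB
  have hne : algebraMap A B b ≠ 0 := fun h => hb (congrArg Subtype.val h)
  -- The zero ideal of the domain `B` lies in the basic open set of `b`, which is therefore
  -- nonempty.
  obtain ⟨s, hs, hsZ⟩ := hZ.inter_open_nonempty
    (PrimeSpectrum.basicOpen (algebraMap A B b) : Set (PrimeSpectrum B))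
    (PrimeSpectrum.basicOpen (algebraMap A B b)).isOpen
    ⟨(⊥ : PrimeSpectrum B), fun h => hne h⟩
  refine ⟨specMap A B s, hs, ?_, ?_⟩
  · have := (specMap A B).isClosedEmbedding.isClosedMap _ (hgood s hsZ).1
    rwa [Set.image_singleton] at this
  · exact FrobeniusBijectiveOnFiber.of_isPullback (IsPullback.of_hasPullback f (specMap A B)) s
      (surjective_residueFieldMap _ s) (hgood s hsZ).2

end FrobeniusReduction

end

/-! ### The reduction to the algebraic numbers -/

theorem proposition5p3
    (Qbar : Type u) [Field Qbar] [Algebra ℚ Qbar] [IsAlgClosure ℚ Qbar]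
    (hQbar : FrobeniusReduction.FrobeniusConjecture.{u} Qbar)
    (k : Type u) [Field k] [IsAlgClosed k] [CharZero k] :
    FrobeniusReduction.FrobeniusConjecture.{u} k := by
  open FrobeniusReduction in
  intro n X π hproj hsmooth hconn A hA XA f g hmodel
  have := hmodel.locallyOfFiniteType
  have := hmodel.quasiCompact
  have := hmodel.flat
  have : IsAlgClosed Qbar := IsAlgClosure.isAlgClosed ℚ
  have : CharZero Qbar := charZero_of_injective_algebraMap (algebraMap ℚ Qbar).injective
  -- `A` is noetherian, so the model is of finite presentation and spreading out applies.
  have : IsNoetherianRing A := Algebra.FiniteType.isNoetherianRing ℤ A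
  have : IsLocallyNoetherian (Spec (CommRingCat.of A)) :=
    inferInstanceAs (IsLocallyNoetherian (Spec (CommRingCat.of A)))
  have : IsLocallyNoetherian XA := LocallyOfFiniteType.isLocallyNoetherian f
  have : QuasiSeparated f := inferInstance
  have : LocallyOfFinitePresentation f := inferInstance
  let e : X ≅ bc f k := hmodel.isPullback.isoPullback
  have he : e.inv ≫ π = bcTo f k := hmodel.isPullback.isoPullback_inv_snd
  have hproj' : IsProjective (bcTo f k) := hproj.of_iso e.symm he
  have hsmooth' : SmoothOfRelativeDimension n (bcTo f k) :=
    MorphismProperty.of_isPullback (P := @SmoothOfRelativeDimension n)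
      (IsPullback.of_horiz_isIso ⟨he.trans (Category.comp_id _).symm⟩ :
        IsPullback e.inv (bcTo f k) π (𝟙 _)) hsmooth
  have : ConnectedSpace (bc f k) := e.hom.homeomorph.surjective.connectedSpace
    e.hom.homeomorph.continuous
  obtain ⟨S, hS, h⟩ := (eventually_isProjective f hproj').and
    ((eventually_smoothOfRelativeDimension f (k := k) n).and (eventually_connectedSpace f (k := k) n))
  have : Algebra.FiniteType A S := S.fg_iff_finiteType.mp hS
  have : Algebra.FiniteType ℤ S := Algebra.FiniteType.trans hA this
  -- The set of all good closed points is taken; its density is tested on nonempty basic open sets.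
  refine ⟨{s | IsClosed {s} ∧ FrobeniusBijectiveOnFiber f s n}, ?_, fun s hs => hs⟩
  refine PrimeSpectrum.isTopologicalBasis_basic_opens.dense_iff.mpr ?_
  rintro _ ⟨b, rfl⟩ ⟨x, hx⟩
  have hb : algebraMap A S b ≠ 0 := by
    intro hb
    obtain rfl : b = 0 := Subtype.ext (congrArg Subtype.val hb :)
    exact hx (Ideal.zero_mem _)
  -- The specialization depends on `b`. It is defined on `S`, not only on `A`, so that the
  -- properties spread out over `S` hold over `Qbar`.
  obtain ⟨ψ, hψ⟩ := exists_ringHom_ne_zero (R := ℤ) ℚ Qbar hb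
  let := (ψ.comp (algebraMap A S)).toAlgebra
  obtain ⟨h₁, h₂, h₃⟩ := h Qbar { ψ with commutes' := fun _ => rfl }
  exact hQbar.exists_mem_basicOpen f n h₁ h₂ (h₃ (Field.toIsField Qbar)) hψ
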